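/- Let $n\ge 1$, let $T>0$, let $\Omega\subset\mathbb R^n$ be a bounded domain (nonempty, open, connected) with smooth boundary and unit outer normal field $\nu$, and let $c\in C^\infty(\Omega)$ be a real wave speed with $0<c_0\le c(x)\le c_1<\infty$ for all $x\in\Omega$. All other functions are real-valued or all are complex-valued. Let $f\in C_c^\infty((0,2T)\times\partial\Omega)$ and let $u^f$, of class $C^2$ on $[0,2T)\times\overline\Omega$, be the classical solution of $$\begin{cases}\partial_t^2u-c^2(x)\Delta u=0 & \text{in }(0,2T)\times\Omega,\\ \partial_\nu u=f & \text{on }(0,2T)\times\partial\Omega,\\ u(0,x)=\partial_tu(0,x)=0 & x\in\Omega.\end{cases}$$ Let $\Lambda_cf:=u^f|_{(0,2T)\times\partial\Omega}$ be the Neumann-to-Dirichlet map. Let $v$ be smooth on $(0,2T)\times\overline\Omega$ (that is, smooth up to the lateral boundary $\partial\Omega$) with $\partial_t^2v-c^2\Delta v=0$ in $(0,2T)\times\Omega$. Write $\mathcal T_Dv(t,\cdot)=v(t,\cdot)|_{\partial\Omega}$ and $\mathcal T_Nv(t,\cdot)=\partial_\nu v(t,\cdot)|_{\partial\Omega}$,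 let $P_T$ be the restriction of functions of time from $(0,2T)$ to $(0,T)$, and put $$Jg(t,\cdot)=\frac12\int_t^{2T-t}g(\tau,\cdot)\,d\tau,\qquad 0<t<T.$$ With $(\varphi,\psi)_{L^2(\Omega,c^{-2}dx)}=\int_\Omega\varphi\psi\,c^{-2}dx$ and $(g,h)_{L^2((0,T)\times\partial\Omega)}=\int_{(0,T)\times\partial\Omega}gh\,dt\,dS$, where $dS$ is the surface measure of $\partial\Omega$, the three integrals below converge absolutely and $$(u^f(T),v(T))_{L^2(\Omega,c^{-2}dx)}=(P_Tf,J\mathcal T_Dv)_{L^2((0,T)\times\partial\Omega)}-(P_T(\Lambda_cf),J\mathcal T_Nv)_{L^2((0,T)\times\partial\Omega)}.$$ -/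

import Mathlib

open Set MeasureTheory
open scoped ContDiff Laplacian

noncomputable section

/-- `ρ` is a smooth local defining function of the open set `Ω` near the boundary point `p`:
on a neighbourhood `U` of `p` the function `ρ` is smooth, `∇ρ(p) ≠ 0`, and `Ω ∩ U = {ρ < 0} ∩ U`. -/
def IsLocalDefiningFunction {n : ℕ} (Ω : Set (EuclideanSpace ℝ (Fin n)))
    (p : EuclideanSpace ℝ (Fin n)) (ρ : EuclideanSpace ℝ (Fin n) → ℝ) : Prop :=
  ∃ U : Set (EuclideanSpace ℝ (Fin n)), IsOpen U ∧ p ∈ U ∧ ContDiffOn ℝ ∞ ρ U ∧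
    gradient ρ p ≠ 0 ∧ ∀ x ∈ U, x ∈ Ω ↔ ρ x < 0

/-- A bounded domain (nonempty connected open set) of `ℝⁿ` with smooth boundary. -/
structure IsBoundedSmoothDomain {n : ℕ} (Ω : Set (EuclideanSpace ℝ (Fin n))) : Prop where
  isOpen : IsOpen Ω
  isConnected : IsConnected Ω
  isBounded : Bornology.IsBounded Ω
  smooth_boundary : ∀ p ∈ frontier Ω, ∃ ρ, IsLocalDefiningFunction Ω p ρ

theorem IsLocalDefiningFunction.differentiableAt {n : ℕ} {Ω : Set (EuclideanSpace ℝ (Fin n))}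
    {p : EuclideanSpace ℝ (Fin n)} {ρ : EuclideanSpace ℝ (Fin n) → ℝ}
    (h : IsLocalDefiningFunction Ω p ρ) : DifferentiableAt ℝ ρ p := by
  obtain ⟨U, hU, hp, hρ, -, -⟩ := h
  exact (hρ.contDiffAt (hU.mem_nhds hp)).differentiableAt (by simp)

theorem IsLocalDefiningFunction.eventually {n : ℕ} {Ω : Set (EuclideanSpace ℝ (Fin n))}
    {p : EuclideanSpace ℝ (Fin n)} {ρ : EuclideanSpace ℝ (Fin n) → ℝ}
    (h : IsLocalDefiningFunction Ω p ρ) : ∀ᶠ x in nhds p, (x ∈ Ω ↔ ρ x < 0) := by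
  obtain ⟨U, hU, hp, -, -, hx⟩ := h
  filter_upwards [hU.mem_nhds hp] with x hxU using hx x hxU

/-- A local defining function vanishes at the boundary point. -/
theorem IsLocalDefiningFunction.eq_zero {n : ℕ} {Ω : Set (EuclideanSpace ℝ (Fin n))}
    (hΩ : IsOpen Ω) {p : EuclideanSpace ℝ (Fin n)} (hp : p ∈ frontier Ω)
    {ρ : EuclideanSpace ℝ (Fin n) → ℝ} (h : IsLocalDefiningFunction Ω p ρ) : ρ p = 0 := by
  rw [hΩ.frontier_eq] at hp
  apply le_antisymm
  · by_contra hlt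
    have h1 : ∀ᶠ x in nhds p, 0 < ρ x :=
      h.differentiableAt.continuousAt.eventually (lt_mem_nhds (not_le.1 hlt))
    have h2 : ∃ᶠ x in nhds p, x ∈ Ω := mem_closure_iff_frequently.1 hp.1
    obtain ⟨x, hx, hx1, hx2⟩ := (h2.and_eventually (h1.and h.eventually)).exists
    exact absurd (hx2.1 hx) (not_lt.2 hx1.le)
  · by_contra hlt
    exact hp.2 (h.eventually.self_of_nhds.2 (not_le.1 hlt))

theorem IsLocalDefiningFunction.hasDerivAt {n : ℕ} {Ω : Set (EuclideanSpace ℝ (Fin n))}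
    {p : EuclideanSpace ℝ (Fin n)} {ρ : EuclideanSpace ℝ (Fin n) → ℝ}
    (h : IsLocalDefiningFunction Ω p ρ) (d : EuclideanSpace ℝ (Fin n)) :
    HasDerivAt (fun t : ℝ => ρ (p + t • d)) (inner ℝ (gradient ρ p) d) 0 := by
  have h1 : HasFDerivAt ρ (InnerProductSpace.toDual ℝ _ (gradient ρ p)) (p + (0 : ℝ) • d) := by
    simpa using h.differentiableAt.hasGradientAt.hasFDerivAt
  have h2 : HasDerivAt (fun t : ℝ => p + t • d) d 0 := by
    simpa using ((hasDerivAt_id (0 : ℝ)).smul_const d).const_add p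
  exact h1.comp_hasDerivAt 0 h2

/-- The unit normal computed from a local defining function does not depend on that function. -/
theorem IsLocalDefiningFunction.normal_unique {n : ℕ} {Ω : Set (EuclideanSpace ℝ (Fin n))}
    (hΩ : IsOpen Ω) {p : EuclideanSpace ℝ (Fin n)} (hp : p ∈ frontier Ω)
    {ρ σ : EuclideanSpace ℝ (Fin n) → ℝ}
    (hρ : IsLocalDefiningFunction Ω p ρ) (hσ : IsLocalDefiningFunction Ω p σ) :
    ‖gradient ρ p‖⁻¹ • gradient ρ p = ‖gradient σ p‖⁻¹ • gradient σ p := by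
  have hg : 0 < ‖gradient ρ p‖ := by
    obtain ⟨U, -, -, -, h, -⟩ := hρ
    exact norm_pos_iff.2 h
  have hk : 0 < ‖gradient σ p‖ := by
    obtain ⟨U, -, -, -, h, -⟩ := hσ
    exact norm_pos_iff.2 h
  set a := ‖gradient ρ p‖⁻¹ • gradient ρ p with ha
  set b := ‖gradient σ p‖⁻¹ • gradient σ p with hb
  have ha1 : ‖a‖ = 1 := by rw [ha, norm_smul, norm_inv, norm_norm, inv_mul_cancel₀ hg.ne']
  have hb1 : ‖b‖ = 1 := by rw [hb, norm_smul, norm_inv, norm_norm, inv_mul_cancel₀ hk.ne']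
  have hga : gradient ρ p = ‖gradient ρ p‖ • a := by
    rw [ha, smul_smul, mul_inv_cancel₀ hg.ne', one_smul]
  have hkb : gradient σ p = ‖gradient σ p‖ • b := by
    rw [hb, smul_smul, mul_inv_cancel₀ hk.ne', one_smul]
  by_contra hne
  have hlt : inner ℝ a b < 1 := inner_lt_one_iff_real_of_norm_eq_one ha1 hb1 |>.2 hne
  have h1 : inner ℝ (gradient ρ p) (b - a) < 0 := by
    rw [hga, real_inner_smul_left, inner_sub_right, real_inner_self_eq_norm_sq, ha1]
    exact mul_neg_of_pos_of_neg hg (by linarith)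
  have h2 : 0 < inner ℝ (gradient σ p) (b - a) := by
    rw [hkb, real_inner_smul_left, inner_sub_right, real_inner_self_eq_norm_sq, hb1,
      real_inner_comm]
    exact mul_pos hk (by linarith)
  have e1 := (hasDerivAt_iff_tendsto_slope_left_right.1 (hρ.hasDerivAt (b - a))).2.eventually
    (gt_mem_nhds h1)
  have e2 := (hasDerivAt_iff_tendsto_slope_left_right.1 (hσ.hasDerivAt (b - a))).2.eventually
    (lt_mem_nhds h2)
  have hc : Filter.Tendsto (fun t : ℝ => p + t • (b - a)) (nhdsWithin 0 (Ioi 0)) (nhds p) := by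
    have : ContinuousAt (fun t : ℝ => p + t • (b - a)) 0 := by fun_prop
    simpa [ContinuousAt] using this.mono_left (nhdsWithin_le_nhds (s := Ioi (0 : ℝ)))
  obtain ⟨t, ht1, ht2, ht, h3, h4⟩ := (e1.and (e2.and
    (Filter.Eventually.and self_mem_nhdsWithin
      ((hc.eventually hρ.eventually).and (hc.eventually hσ.eventually))))).exists
  have ht : 0 < t := ht
  simp only [slope_def_field, zero_smul, add_zero, sub_zero, hρ.eq_zero hΩ hp,
    hσ.eq_zero hΩ hp] at ht1 ht2
  have h5 : ρ (p + t • (b - a)) < 0 := by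
    by_contra hh
    exact absurd ht1 (not_lt.2 (div_nonneg (not_lt.1 hh) ht.le))
  have h6 : 0 < σ (p + t • (b - a)) := by
    by_contra hh
    exact absurd ht2 (not_lt.2 (div_nonpos_of_nonpos_of_nonneg (not_lt.1 hh) ht.le))
  exact absurd (h4.1 (h3.2 h5)) (not_lt.2 h6.le)

open Classical in
/-- The unit outer normal `ν(p) = ∇ρ(p) / |∇ρ(p)|` at a boundary point `p` of `Ω`, where `ρ` is any
local defining function (see `outerNormal_eq` for the independence of `ρ`). -/
def outerNormal {n : ℕ} (Ω : Set (EuclideanSpace ℝ (Fin n)))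
    (p : EuclideanSpace ℝ (Fin n)) : EuclideanSpace ℝ (Fin n) :=
  if h : ∃ ρ, IsLocalDefiningFunction Ω p ρ then
    ‖gradient h.choose p‖⁻¹ • gradient h.choose p
  else 0

theorem outerNormal_eq {n : ℕ} {Ω : Set (EuclideanSpace ℝ (Fin n))}
    (hΩ : IsOpen Ω) {p : EuclideanSpace ℝ (Fin n)} (hp : p ∈ frontier Ω)
    {ρ : EuclideanSpace ℝ (Fin n) → ℝ} (hρ : IsLocalDefiningFunction Ω p ρ) :
    outerNormal Ω p = ‖gradient ρ p‖⁻¹ • gradient ρ p := by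
  have h : ∃ ρ, IsLocalDefiningFunction Ω p ρ := ⟨ρ, hρ⟩
  rw [outerNormal, dif_pos h]
  exact h.choose_spec.normal_unique hΩ hp hρ

/-- The surface measure of `∂Ω`: the normalized `(n-1)`-dimensional Hausdorff measure on `∂Ω`. -/
def surfaceMeasure {n : ℕ} (Ω : Set (EuclideanSpace ℝ (Fin n))) :
    Measure (EuclideanSpace ℝ (Fin n)) :=
  (μHE[n - 1] : Measure (EuclideanSpace ℝ (Fin n))).restrict (frontier Ω)

/-! Functions of time `t` and of a point of `∂Ω` are represented by functions
`ℝ → EuclideanSpace ℝ (Fin n) → 𝕜`, of which only the values at `x ∈ ∂Ω` matter. -/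

/-- The Dirichlet trace `𝒯_D u (t, ·) = u(t, ·)|_{∂Ω}` (extended by `0` off `∂Ω`). -/
def dirichletTrace {n : ℕ} {𝕜 : Type*} [RCLike 𝕜] (Ω : Set (EuclideanSpace ℝ (Fin n)))
    (u : ℝ → EuclideanSpace ℝ (Fin n) → 𝕜) : ℝ → EuclideanSpace ℝ (Fin n) → 𝕜 :=
  fun t => (frontier Ω).indicator (u t)

/-- The Neumann trace `𝒯_N u (t, ·) = ∂_ν u(t, ·)|_{∂Ω}` (extended by `0` off `∂Ω`). The derivative
is taken within the closure of `Ω`, so it only uses the values of `u` there. -/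
def neumannTrace {n : ℕ} {𝕜 : Type*} [RCLike 𝕜] (Ω : Set (EuclideanSpace ℝ (Fin n)))
    (u : ℝ → EuclideanSpace ℝ (Fin n) → 𝕜) : ℝ → EuclideanSpace ℝ (Fin n) → 𝕜 :=
  fun t => (frontier Ω).indicator
    fun x => fderivWithin ℝ (u t) (closure Ω) x (outerNormal Ω x)

/-- `u` satisfies `(∂ₜ² - c² Δ) u = 0` pointwise in `(0, S) × Ω`. -/
def SatisfiesWaveEquation {n : ℕ} {𝕜 : Type*} [RCLike 𝕜] (Ω : Set (EuclideanSpace ℝ (Fin n)))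
    (c : EuclideanSpace ℝ (Fin n) → ℝ) (S : ℝ)
    (u : ℝ → EuclideanSpace ℝ (Fin n) → 𝕜) : Prop :=
  ∀ t ∈ Ioo 0 S, ∀ x ∈ Ω,
    iteratedDeriv 2 (fun s => u s x) t - (c x ^ 2) • (Δ (u t)) x = 0

/-- `f ∈ C_c^∞((0, S) × ∂Ω)`. -/
def IsSmoothCompactBoundaryData {n : ℕ} {𝕜 : Type*} [RCLike 𝕜]
    (Ω : Set (EuclideanSpace ℝ (Fin n))) (S : ℝ)
    (f : ℝ → EuclideanSpace ℝ (Fin n) → 𝕜) : Prop :=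
  ContDiffOn ℝ ∞ (fun p : ℝ × EuclideanSpace ℝ (Fin n) => f p.1 p.2)
      (Ioo 0 S ×ˢ frontier Ω) ∧
    ∃ K : Set (ℝ × EuclideanSpace ℝ (Fin n)), IsCompact K ∧ K ⊆ Ioo 0 S ×ˢ frontier Ω ∧
      ∀ p ∈ (Ioo 0 S ×ˢ frontier Ω) \ K, f p.1 p.2 = 0

/-- `u` is a classical solution of the Neumann initial-boundary value problem on `(0, S) × Ω`
with Neumann data `f` and zero initial data. -/
structure IsNeumannSolution {n : ℕ} {𝕜 : Type*} [RCLike 𝕜] (Ω : Set (EuclideanSpace ℝ (Fin n)))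
    (c : EuclideanSpace ℝ (Fin n) → ℝ) (S : ℝ)
    (f u : ℝ → EuclideanSpace ℝ (Fin n) → 𝕜) : Prop where
  contDiffOn : ContDiffOn ℝ 2 (fun p : ℝ × EuclideanSpace ℝ (Fin n) => u p.1 p.2)
    (Ico 0 S ×ˢ closure Ω)
  wave : SatisfiesWaveEquation Ω c S u
  neumann : ∀ t ∈ Ioo 0 S, ∀ x ∈ frontier Ω, neumannTrace Ω u t x = f t x
  initial : ∀ x ∈ Ω, u 0 x = 0
  initial_deriv : ∀ x ∈ Ω, derivWithin (fun s => u s x) (Ici 0) 0 = 0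

open Classical in
/-- The Neumann-to-Dirichlet map `Λ_c f = u^f|_{(0,S) × ∂Ω}`, where `u^f` is the solution with
Neumann data `f` (`0` if there is none). -/
def neumannToDirichlet {n : ℕ} {𝕜 : Type*} [RCLike 𝕜] (Ω : Set (EuclideanSpace ℝ (Fin n)))
    (c : EuclideanSpace ℝ (Fin n) → ℝ) (S : ℝ)
    (f : ℝ → EuclideanSpace ℝ (Fin n) → 𝕜) : ℝ → EuclideanSpace ℝ (Fin n) → 𝕜 :=
  if h : ∃ u, IsNeumannSolution Ω c S f u then dirichletTrace Ω h.choose else 0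

/-- `P_T`: restriction of a function of time to `(0, T)` (extended by `0`). -/
def timeRestrict {n : ℕ} {𝕜 : Type*} [RCLike 𝕜] (T : ℝ)
    (g : ℝ → EuclideanSpace ℝ (Fin n) → 𝕜) : ℝ → EuclideanSpace ℝ (Fin n) → 𝕜 :=
  (Ioo 0 T).indicator g

/-- The low-pass filter `J g (t, ·) = ½ ∫_t^{2T-t} g(τ, ·) dτ`. -/
def lowPass {n : ℕ} {𝕜 : Type*} [RCLike 𝕜] (T : ℝ)
    (g : ℝ → EuclideanSpace ℝ (Fin n) → 𝕜) : ℝ → EuclideanSpace ℝ (Fin n) → 𝕜 :=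
  fun t x => (1 / 2 : ℝ) • ∫ τ in t..(2 * T - t), g τ x

/-- The measure `dt ⊗ dS` on `(0, T) × ∂Ω`. -/
def lateralMeasure {n : ℕ} (Ω : Set (EuclideanSpace ℝ (Fin n))) (T : ℝ) :
    Measure (ℝ × EuclideanSpace ℝ (Fin n)) :=
  (volume.restrict (Ioo 0 T)).prod (surfaceMeasure Ω)

/-- The (bilinear) pairing `(g, h)_{L²((0,T) × ∂Ω)} = ∫_{(0,T) × ∂Ω} g h dt dS`. -/
def lateralPairing {n : ℕ} {𝕜 : Type*} [RCLike 𝕜] (Ω : Set (EuclideanSpace ℝ (Fin n))) (T : ℝ)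
    (g h : ℝ → EuclideanSpace ℝ (Fin n) → 𝕜) : 𝕜 :=
  ∫ p, g p.1 p.2 * h p.1 p.2 ∂(lateralMeasure Ω T)

/-- The integral defining `lateralPairing Ω T g h` converges absolutely. -/
def LateralPairable {n : ℕ} {𝕜 : Type*} [RCLike 𝕜] (Ω : Set (EuclideanSpace ℝ (Fin n))) (T : ℝ)
    (g h : ℝ → EuclideanSpace ℝ (Fin n) → 𝕜) : Prop :=
  Integrable (fun p : ℝ × EuclideanSpace ℝ (Fin n) => g p.1 p.2 * h p.1 p.2) (lateralMeasure Ω T)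

/-- The (bilinear) pairing `(φ, ψ)_{L²(Ω, c⁻² dx)} = ∫_Ω φ ψ c⁻² dx`. -/
def weightedPairing {n : ℕ} {𝕜 : Type*} [RCLike 𝕜] (Ω : Set (EuclideanSpace ℝ (Fin n)))
    (c : EuclideanSpace ℝ (Fin n) → ℝ) (φ ψ : EuclideanSpace ℝ (Fin n) → 𝕜) : 𝕜 :=
  ∫ x in Ω, ((c x ^ 2)⁻¹ : ℝ) • (φ x * ψ x)

/-- The integral defining `weightedPairing Ω c φ ψ` converges absolutely. -/
def WeightedPairable {n : ℕ} {𝕜 : Type*} [RCLike 𝕜] (Ω : Set (EuclideanSpace ℝ (Fin n)))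
    (c : EuclideanSpace ℝ (Fin n) → ℝ) (φ ψ : EuclideanSpace ℝ (Fin n) → 𝕜) : Prop :=
  IntegrableOn (fun x => ((c x ^ 2)⁻¹ : ℝ) • (φ x * ψ x)) Ω volume

end

/-! This is the Blagoveshchenskii identity. For fixed `x`, the product `u(T) v(T)` is the integral
over time of `∂ₜ²u · Jv - u · J(∂ₜ²v)`, because `∂ₜ(Jv)(t) = -(v(t) + v(2T - t)) / 2` and
`J(∂ₜ²v)(t) = (∂ₜv(2T - t) - ∂ₜv(t)) / 2`; this is `mul_eq_integral_lowPass`. Dividing by `c²`,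
integrating over `Ω` and using the wave equation at both times gives an integral over the triangle
`t < τ < 2T - t` of `∫_Ω (Δu(t) v(τ) - u(t) Δv(τ)) dx`. Green's second identity turns the inner
integral into boundary terms, and Fubini's theorem reassembles these into the two lateral pairings
(`weightedPairing_eq_sub`).

Nothing controls `v` near the times `0` and `2T`, so the computation is made on `[δ, 2T - δ]`, where
`u` has to start from rest at `δ`. Since `f` vanishes for `t < ε`, it suffices to know that a
solution with zero Neumann data vanishes. This uniqueness follows from the same identity, applied
with `δ = 0` to the solution `w` and its conjugate: the boundary terms drop out and `∫_Ω c⁻² |w(T)|²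
dx = 0`. As the identity at time `T` uses data up to `2T`, only the first half of the time interval
is reached (`IsNeumannSolution.eq_zero`). That is enough, both for `u` at small times and for
identifying `Λ_c f` with the trace of `u` on `(0, T)`, which is all that `P_T` sees.

The remaining work is Gauss' theorem, with the normalized Hausdorff measure as surface measure. Near
a boundary point with normal `ν`, integrate `∂_{ν+e} φ`, for `e ⊥ ν` and `|e| ≤ 1`, along the lines
parallel to `ν + e`. Each line leaves `Ω` at most once within the chart, so the result is the
integral of `φ` against the pullback of Lebesgue measure under an oblique projection of `∂Ω` to
`ν^⊥`. In a small chart this projection is nearly isometric on `∂Ω`, so the pulled back measure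
agrees with surface measure up to a factor close to `1`. Hence Gauss' formula holds locally with
error at most `η ∫ |φ| dS`. These errors add up to `η ∫ |φ| dS` over a partition of unity, however
many pieces it has, and `η` is arbitrary. No change of variables formula or surface Jacobian is
needed. -/

noncomputable section

/-! ### Boundary charts and unique differentiability on the closure. -/

/-- Near the boundary point `p`, the open set `Ω` is the sublevel set `{ρ < 0}` of a function `ρ`
that is `ε`-close to the linear function with gradient `ν`. -/
structure IsNormalChart {E : Type*} [NormedAddCommGroup E] [InnerProductSpace ℝ E]
    (Ω : Set E) (p ν : E) (r ε : ℝ) (ρ : E → ℝ) : Prop where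
  pos : 0 < r
  norm_normal : ‖ν‖ = 1
  approx : ∀ x ∈ Metric.ball p r, ∀ y ∈ Metric.ball p r,
    |ρ x - ρ y - inner ℝ ν (x - y)| ≤ ε * ‖x - y‖
  mem_iff : ∀ x ∈ Metric.ball p r, x ∈ Ω ↔ ρ x < 0
  mem_frontier_iff : ∀ x ∈ Metric.ball p r, x ∈ frontier Ω ↔ ρ x = 0

section Chart

variable {n : ℕ} {Ω : Set (EuclideanSpace ℝ (Fin n))}

theorem IsLocalDefiningFunction.eventually_isLocalDefiningFunction
    {p : EuclideanSpace ℝ (Fin n)} {ρ : EuclideanSpace ℝ (Fin n) → ℝ}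
    (h : IsLocalDefiningFunction Ω p ρ) :
    ContinuousAt (gradient ρ) p ∧ ∀ᶠ x in nhds p, IsLocalDefiningFunction Ω x ρ := by
  obtain ⟨U, hU, hp, hρ, hg, hx⟩ := h
  have h1 : ContinuousOn (fderiv ℝ ρ) U := hρ.continuousOn_fderiv_of_isOpen hU (by simp)
  have h2 : ContinuousAt (gradient ρ) p := by
    have := (InnerProductSpace.toDual ℝ (EuclideanSpace ℝ (Fin n))).symm.continuous.continuousAt.comp
      (h1.continuousAt (hU.mem_nhds hp))
    exact this
  refine ⟨h2, ?_⟩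
  filter_upwards [hU.mem_nhds hp, h2.eventually_ne hg] with x hxU hxg
  exact ⟨U, hU, hxU, hρ, hxg, hx⟩

/-- A defining function divided by the length of its gradient at `p` has gradient `ν(p)` there.
Strict differentiability at `p`, rather than mere differentiability, gives the estimate for pairs of
points, which later controls both the lines crossing `∂Ω` and the distances on `∂Ω`. -/
theorem IsBoundedSmoothDomain.exists_isNormalChart (hΩ : IsBoundedSmoothDomain Ω)
    {p : EuclideanSpace ℝ (Fin n)} (hp : p ∈ frontier Ω) {ε : ℝ} (hε : 0 < ε) (hε1 : ε < 1) :
    ∃ r ρ, IsNormalChart Ω p (outerNormal Ω p) r ε ρ ∧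
      ∀ x ∈ Metric.ball p r, x ∈ frontier Ω → ‖outerNormal Ω x - outerNormal Ω p‖ ≤ ε := by
  obtain ⟨σ, hσ⟩ := hΩ.smooth_boundary p hp
  obtain ⟨hcont, hev⟩ := hσ.eventually_isLocalDefiningFunction
  have hν := outerNormal_eq hΩ.isOpen hp hσ
  set N := ‖gradient σ p‖ with hN
  have hσ' := hσ
  obtain ⟨U, hU, hpU, hsm, hg, hx⟩ := hσ'
  have hNpos : 0 < N := norm_pos_iff.2 hg
  have hstrict : HasStrictFDerivAt σ (fderiv ℝ σ p) p :=
    (hsm.contDiffAt (hU.mem_nhds hpU)).hasStrictFDerivAt (by simp)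
  have h1 : ∀ᶠ z : EuclideanSpace ℝ (Fin n) × EuclideanSpace ℝ (Fin n) in nhds (p, p),
      ‖σ z.1 - σ z.2 - fderiv ℝ σ p (z.1 - z.2)‖ ≤ (N * ε) * ‖z.1 - z.2‖ :=
    hstrict.isLittleO.def (mul_pos hNpos hε)
  have hcont2 : ContinuousAt (fun x => ‖gradient σ x‖⁻¹ • gradient σ x) p :=
    (hcont.norm.inv₀ hNpos.ne').smul hcont
  have h2 : ∀ᶠ x in nhds p, ‖‖gradient σ x‖⁻¹ • gradient σ x - outerNormal Ω p‖ < ε := by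
    have := hcont2.eventually (Metric.ball_mem_nhds _ hε)
    filter_upwards [this] with x hx
    rw [hν]
    simpa [dist_eq_norm] using hx
  rw [nhds_prod_eq] at h1
  obtain ⟨A, hA, B, hB, hAB⟩ := Filter.mem_prod_iff.1 h1
  obtain ⟨r, hr, hball⟩ := Metric.mem_nhds_iff.1
    (Filter.inter_mem (Filter.inter_mem hA hB) (Filter.inter_mem (Filter.inter_mem hev h2)
      (hU.mem_nhds hpU)))
  have hnorm : ‖outerNormal Ω p‖ = 1 := by
    rw [hν, norm_smul, norm_inv, norm_norm, inv_mul_cancel₀ hNpos.ne']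
  have happrox : ∀ x ∈ Metric.ball p r, ∀ y ∈ Metric.ball p r,
      |N⁻¹ * σ x - N⁻¹ * σ y - inner ℝ (outerNormal Ω p) (x - y)| ≤ ε * ‖x - y‖ := by
    intro x hx y hy
    have := @hAB (x, y) ⟨(hball hx).1.1, (hball hy).1.2⟩
    simp only [mem_ofPred_eq] at this
    have e1 : fderiv ℝ σ p (x - y) = N * inner ℝ (outerNormal Ω p) (x - y) := by
      rw [hν, real_inner_smul_left, mul_inv_cancel_left₀ hNpos.ne', inner_gradient_left]
    rw [e1, Real.norm_eq_abs] at this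
    have e2 : N⁻¹ * σ x - N⁻¹ * σ y - inner ℝ (outerNormal Ω p) (x - y)
        = N⁻¹ * (σ x - σ y - N * inner ℝ (outerNormal Ω p) (x - y)) := by
      field_simp
    rw [e2, abs_mul, abs_of_pos (inv_pos.2 hNpos)]
    calc _ ≤ N⁻¹ * (N * ε * ‖x - y‖) := by gcongr
      _ = _ := by field_simp
  have hmem : ∀ x ∈ Metric.ball p r, x ∈ Ω ↔ N⁻¹ * σ x < 0 := by
    intro x hxb
    rw [hx x (hball hxb).2.2]
    constructor
    · intro h; exact mul_neg_of_pos_of_neg (inv_pos.2 hNpos) h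
    · intro h; exact (pos_iff_neg_of_mul_neg h).1 (inv_pos.2 hNpos)
  refine ⟨r, fun x => N⁻¹ * σ x, ⟨hr, hnorm, happrox, hmem, ?_⟩, ?_⟩
  · intro x hxb
    constructor
    · intro hxf
      rw [(hball hxb).2.1.1.eq_zero hΩ.isOpen hxf, mul_zero]
    · intro h0
      rw [hΩ.isOpen.frontier_eq]
      refine ⟨?_, fun hh => absurd ((hmem x hxb).1 hh) (by rw [h0]; exact lt_irrefl _)⟩
      -- A zero of `ρ` is a limit of points of `Ω`: moving by `-tν` lowers `ρ` by at least `(1 - ε)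
      -- t`, which is positive because `ε < 1`.
      have hc : Filter.Tendsto (fun t : ℝ => x - t • outerNormal Ω p) (nhdsWithin 0 (Ioi 0))
          (nhds x) := by
        have : ContinuousAt (fun t : ℝ => x - t • outerNormal Ω p) 0 := by fun_prop
        simpa [ContinuousAt] using this.mono_left (nhdsWithin_le_nhds (s := Ioi (0 : ℝ)))
      refine mem_closure_of_tendsto hc ?_
      filter_upwards [hc (Metric.isOpen_ball.mem_nhds hxb), self_mem_nhdsWithin] with t ht htpos
      have htpos : 0 < t := htpos
      rw [hmem _ ht]
      have h3 := happrox _ ht x hxb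
      rw [h0] at h3
      have e1 : x - t • outerNormal Ω p - x = -(t • outerNormal Ω p) := by abel
      rw [e1, inner_neg_right, real_inner_smul_right, real_inner_self_eq_norm_sq, norm_neg,
        norm_smul, hnorm, Real.norm_of_nonneg htpos.le] at h3
      have := (abs_le.1 h3).2
      nlinarith
  · intro x hxb hxf
    rw [outerNormal_eq hΩ.isOpen hxf (hball hxb).2.1.1]
    exact (hball hxb).2.1.2.le

theorem IsBoundedSmoothDomain.continuousOn_outerNormal (hΩ : IsBoundedSmoothDomain Ω) :
    ContinuousOn (outerNormal Ω) (frontier Ω) := by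
  intro p hp
  rw [Metric.continuousWithinAt_iff]
  intro ε hε
  obtain ⟨r, ρ, h, h2⟩ := hΩ.exists_isNormalChart hp (ε := min (ε / 2) (1 / 2))
    (by positivity) (lt_of_le_of_lt (min_le_right _ _) (by norm_num))
  refine ⟨r, h.pos, fun x hx hxr => ?_⟩
  rw [dist_eq_norm]
  exact lt_of_le_of_lt ((h2 x hxr hx).trans (min_le_left _ _)) (by linarith)

/-- The closure of a smooth bounded domain contains a truncated open cone at each boundary point. -/
theorem IsBoundedSmoothDomain.uniqueDiffOn_closure (hΩ : IsBoundedSmoothDomain Ω) :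
    UniqueDiffOn ℝ (closure Ω) := by
  intro p hp
  by_cases hpΩ : p ∈ Ω
  · exact (hΩ.isOpen.uniqueDiffWithinAt hpΩ).mono subset_closure
  have hpf : p ∈ frontier Ω := by rw [hΩ.isOpen.frontier_eq]; exact ⟨hp, hpΩ⟩
  obtain ⟨r, ρ, h, -⟩ := hΩ.exists_isNormalChart hpf (ε := 1 / 2) (by norm_num) (by norm_num)
  set ν := outerNormal Ω p
  have hr := h.pos
  -- The aperture `3/4` lies strictly between `ε = 1/2`, so that `ρ < 0` on the cone, and `1`, so
  -- that the cone contains its axis direction `-ν`.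
  let C : Set (EuclideanSpace ℝ (Fin n)) :=
    {x | (3 / 4) * ‖x - p‖ < - inner ℝ ν (x - p)} ∩ Metric.ball p r
  have hCΩ : C ⊆ Ω := by
    rintro x ⟨hx1, hx2⟩
    rw [h.mem_iff x hx2]
    have := h.approx x hx2 p (Metric.mem_ball_self hr)
    rw [(h.mem_frontier_iff p (Metric.mem_ball_self hr)).1 hpf] at this
    have h3 := (abs_le.1 this).2
    have hx1 : (3 / 4) * ‖x - p‖ < - inner ℝ ν (x - p) := hx1
    have := norm_nonneg (x - p)
    linarith
  have hCopen : IsOpen C :=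
    (isOpen_lt (by fun_prop) (by fun_prop)).inter Metric.isOpen_ball
  have hCconv : Convex ℝ C := by
    refine Convex.inter ?_ (convex_ball p r)
    intro x hx y hy a b ha hb hab
    simp only [mem_ofPred_eq] at hx hy ⊢
    have e : a • x + b • y - p = a • (x - p) + b • (y - p) := by
      have : p = (a + b) • p := by rw [hab, one_smul]
      nth_rewrite 1 [this]
      module
    rw [e, inner_add_right, real_inner_smul_right, real_inner_smul_right]
    have h1 : ‖a • (x - p) + b • (y - p)‖ ≤ a * ‖x - p‖ + b * ‖y - p‖ := by
      refine (norm_add_le _ _).trans ?_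
      rw [norm_smul, norm_smul, Real.norm_of_nonneg ha, Real.norm_of_nonneg hb]
    rcases ha.eq_or_lt with rfl | ha'
    · have : b = 1 := by linarith
      subst this
      linarith
    · nlinarith [mul_lt_mul_of_pos_left hx ha', mul_le_mul_of_nonneg_left hy.le hb]
  have hmemC : ∀ t ∈ Ioo 0 r, p - t • ν ∈ C := by
    intro t ht
    have e : p - t • ν - p = -(t • ν) := by abel
    refine ⟨?_, ?_⟩
    · simp only [mem_ofPred_eq]
      rw [e, inner_neg_right, real_inner_smul_right, real_inner_self_eq_norm_sq, norm_neg,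
        norm_smul, h.norm_normal, Real.norm_of_nonneg ht.1.le]
      linarith [ht.1]
    · rw [Metric.mem_ball, dist_eq_norm, e, norm_neg, norm_smul, h.norm_normal,
        Real.norm_of_nonneg ht.1.le]
      linarith [ht.2]
  have hpC : p ∈ closure C := by
    have hc : Filter.Tendsto (fun t : ℝ => p - t • ν) (nhdsWithin 0 (Ioi 0)) (nhds p) := by
      have : ContinuousAt (fun t : ℝ => p - t • ν) 0 := by fun_prop
      simpa [ContinuousAt] using this.mono_left (nhdsWithin_le_nhds (s := Ioi (0 : ℝ)))
    refine mem_closure_of_tendsto hc ?_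
    filter_upwards [Ioo_mem_nhdsGT hr] with t ht using hmemC t ht
  refine (uniqueDiffWithinAt_convex hCconv ?_ hpC).mono (hCΩ.trans subset_closure)
  rw [hCopen.interior_eq]
  exact ⟨_, hmemC (r / 2) ⟨by linarith, by linarith⟩⟩

end Chart

/-! ### The fundamental theorem of calculus along lines transversal to the boundary. -/

/-- `φ` is continuous on `closure Ω` and continuously differentiable on `Ω` with bounded derivative. -/
structure IsC1UpToBoundary {E F : Type*} [NormedAddCommGroup E] [NormedSpace ℝ E]
    [NormedAddCommGroup F] [NormedSpace ℝ F] (Ω : Set E) (φ : E → F) : Prop where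
  continuousOn : ContinuousOn φ (closure Ω)
  contDiffOn : ContDiffOn ℝ 1 φ Ω
  bounded : ∃ C, ∀ x ∈ Ω, ‖fderiv ℝ φ x‖ ≤ C

section Line

variable {E F : Type*} [NormedAddCommGroup E] [InnerProductSpace ℝ E]
  [NormedAddCommGroup F] [NormedSpace ℝ F]
  {Ω : Set E} {p ν : E} {r ε : ℝ} {ρ : E → ℝ} {φ : E → F} {a : E}

theorem fderiv_eq_zero_of_notMem_tsupport {x : E} (hx : x ∉ tsupport φ) :
    fderiv ℝ φ x = 0 :=
  Function.notMem_support.1 fun h => hx (support_fderiv_subset ℝ h)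

theorem abs_lt_of_line_mem_ball (ha : 1 ≤ ‖a‖) {q : E} {s : ℝ}
    (hs : q + s • a ∈ Metric.ball p r) : |s| < r + ‖q - p‖ := by
  rw [Metric.mem_ball, dist_eq_norm] at hs
  have h2 : ‖s • a‖ ≤ ‖q + s • a - p‖ + ‖q - p‖ :=
    calc ‖s • a‖ = ‖(q + s • a - p) - (q - p)‖ := by congr 1; abel
      _ ≤ _ := norm_sub_le _ _
  rw [norm_smul, Real.norm_eq_abs] at h2
  nlinarith [abs_nonneg s]

/-- The integral along a line of a derivative in the direction of the line, when the line leaves `Ω`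
at the parameter `s₀`. -/
theorem integral_line_eq [CompleteSpace F] (hΩ : IsOpen Ω) (hφ : IsC1UpToBoundary Ω φ)
    (hsupp : tsupport φ ⊆ Metric.ball p r) (ha : 1 ≤ ‖a‖) (q : E) (s₀ : ℝ)
    (hlt : ∀ s < s₀, q + s • a ∈ Metric.ball p r → q + s • a ∈ Ω)
    (hge : ∀ s, s₀ ≤ s → q + s • a ∈ Metric.ball p r → q + s • a ∉ Ω)
    (hc : ContinuousWithinAt (fun s : ℝ => φ (q + s • a)) (Iic s₀) s₀) :
    ∫ s : ℝ, Ω.indicator (fun x => fderiv ℝ φ x a) (q + s • a) = φ (q + s₀ • a) := by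
  have hline : Continuous fun s : ℝ => q + s • a := by fun_prop
  -- The line may meet `Ω` again outside the ball, but there the derivative of `φ` is zero. So the
  -- indicator of `Ω` can be replaced by that of the half-line before `s₀`.
  have hEq : (fun s : ℝ => Ω.indicator (fun x => fderiv ℝ φ x a) (q + s • a))
      = (Iio s₀).indicator (fun s => fderiv ℝ φ (q + s • a) a) := by
    funext s
    by_cases hs : q + s • a ∈ tsupport φ
    · by_cases hs0 : s < s₀
      · rw [indicator_of_mem (hlt s hs0 (hsupp hs)), indicator_of_mem (by exact hs0)]
      · rw [indicator_of_notMem (hge s (not_lt.1 hs0) (hsupp hs)), indicator_of_notMem (by exact hs0)]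
    · have h0 := fderiv_eq_zero_of_notMem_tsupport hs
      by_cases hsΩ : q + s • a ∈ Ω <;> by_cases hs0 : s < s₀ <;> simp [hsΩ, hs0, h0]
  have hbd : ∀ s : ℝ, q + s • a ∈ tsupport φ → |s| ≤ r + ‖q - p‖ := by
    exact fun s hs => (abs_lt_of_line_mem_ball ha (hsupp hs)).le
  have hderiv : ∀ s ∈ Iio s₀, HasDerivAt (fun s : ℝ => φ (q + s • a)) (fderiv ℝ φ (q + s • a) a) s := by
    intro s hs
    have hl : HasDerivAt (fun s : ℝ => q + s • a) a s := by
      simpa using ((hasDerivAt_id s).smul_const a).const_add q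
    have hd : DifferentiableAt ℝ φ (q + s • a) := by
      by_cases h : q + s • a ∈ tsupport φ
      · exact (hφ.contDiffOn.contDiffAt (hΩ.mem_nhds (hlt s hs (hsupp h)))).differentiableAt (by simp)
      · have h1 : φ =ᶠ[nhds (q + s • a)] fun _ => 0 := notMem_tsupport_iff_eventuallyEq.1 h
        exact (h1.differentiableAt_iff).2 (differentiableAt_const _)
    exact hd.hasFDerivAt.comp_hasDerivAt s hl
  have hcont : ContinuousOn (fun s : ℝ => fderiv ℝ φ (q + s • a) a) (Iio s₀) := by
    intro s hs
    apply ContinuousAt.continuousWithinAt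
    have : ContinuousAt (fderiv ℝ φ) (q + s • a) := by
      by_cases h : q + s • a ∈ tsupport φ
      · exact (hφ.contDiffOn.continuousOn_fderiv_of_isOpen hΩ (by simp)).continuousAt
          (hΩ.mem_nhds (hlt s hs (hsupp h)))
      · have h1 : φ =ᶠ[nhds (q + s • a)] fun _ => 0 := notMem_tsupport_iff_eventuallyEq.1 h
        have h2 := h1.fderiv (𝕜 := ℝ)
        refine ContinuousAt.congr ?_ h2.symm
        simp only [fderiv_fun_const]
        exact continuousAt_const
    have h3 : ContinuousAt (fun s : ℝ => fderiv ℝ φ (q + s • a)) s :=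
      ContinuousAt.comp (f := fun s : ℝ => q + s • a) this hline.continuousAt
    exact h3.clm_apply continuousAt_const
  obtain ⟨C, hC⟩ := hφ.bounded
  have hint : IntegrableOn (fun s : ℝ => fderiv ℝ φ (q + s • a) a) (Iic s₀) := by
    rw [integrableOn_Iic_iff_integrableOn_Iio]
    set R := r + ‖q - p‖
    have hdom : Integrable ((Icc (-R) R).indicator fun _ : ℝ => |C| * ‖a‖)
        (volume.restrict (Iio s₀)) := by
      refine Integrable.mono_measure ?_ Measure.restrict_le_self
      rw [integrable_indicator_iff measurableSet_Icc]
      exact integrableOn_const (by simp)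
    refine hdom.mono' (hcont.aestronglyMeasurable measurableSet_Iio) ?_
    refine (ae_restrict_iff' measurableSet_Iio).2 (ae_of_all _ fun s hs => ?_)
    by_cases h : q + s • a ∈ tsupport φ
    · rw [indicator_of_mem (mem_Icc.2 (abs_le.1 (hbd s h)))]
      refine (ContinuousLinearMap.le_opNorm _ _).trans ?_
      gcongr
      exact (hC _ (hlt s hs (hsupp h))).trans (le_abs_self C)
    · rw [fderiv_eq_zero_of_notMem_tsupport h]
      simp only [zero_apply, norm_zero]
      exact indicator_nonneg (fun _ _ => by positivity) _
  have hlim : Filter.Tendsto (fun s : ℝ => φ (q + s • a)) Filter.atBot (nhds 0) := by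
    refine tendsto_const_nhds.congr' ?_
    filter_upwards [Filter.eventually_lt_atBot (-(r + ‖q - p‖))] with s hs
    symm
    by_contra hne
    have := (abs_le.1 (hbd s (subset_tsupport φ hne))).1
    linarith
  rw [hEq, integral_indicator measurableSet_Iio, ← integral_Iic_eq_integral_Iio,
    integral_Iic_of_hasDerivAt_of_tendsto hc hderiv hint hlim, sub_zero]

/-- Along `a` the linear part of `ρ` grows at rate `⟪ν, a⟫ = 1`, while the error has rate at most `ε
‖a‖ ≤ 1/2`. Hence a line in direction `a` crosses `∂Ω` at most once inside the ball, and from the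
inside to the outside. -/
theorem IsNormalChart.lt_of_lt (h : IsNormalChart Ω p ν r ε ρ) (hε : ε ≤ 1 / 4)
    (haν : inner ℝ ν a = 1) (ha : ‖a‖ ≤ 2) {q : E} {s t : ℝ} (hst : s < t)
    (hs : q + s • a ∈ Metric.ball p r) (ht : q + t • a ∈ Metric.ball p r) :
    ρ (q + s • a) < ρ (q + t • a) := by
  have h1 := (abs_le.1 (h.approx _ ht _ hs)).1
  have e : q + t • a - (q + s • a) = (t - s) • a := by module
  rw [e, real_inner_smul_right, haν, norm_smul, Real.norm_of_nonneg (by linarith)] at h1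
  have h0 : 0 ≤ (t - s) * ‖a‖ := mul_nonneg (by linarith) (norm_nonneg a)
  nlinarith [mul_le_mul_of_nonneg_left ha (sub_nonneg.2 hst.le)]

theorem IsNormalChart.one_le_norm (h : IsNormalChart Ω p ν r ε ρ) (haν : inner ℝ ν a = 1) :
    1 ≤ ‖a‖ := by
  have := real_inner_le_norm ν a
  rwa [haν, h.norm_normal, one_mul] at this

theorem IsNormalChart.integral_line_of_mem_frontier [CompleteSpace F]
    (h : IsNormalChart Ω p ν r ε ρ) (hΩ : IsOpen Ω)
    (hε : ε ≤ 1 / 4) (haν : inner ℝ ν a = 1) (ha : ‖a‖ ≤ 2) (hφ : IsC1UpToBoundary Ω φ)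
    (hsupp : tsupport φ ⊆ Metric.ball p r) {q : E} {s₀ : ℝ}
    (hs₀ : q + s₀ • a ∈ Metric.ball p r) (hs₀' : q + s₀ • a ∈ frontier Ω) :
    ∫ s : ℝ, Ω.indicator (fun x => fderiv ℝ φ x a) (q + s • a) = φ (q + s₀ • a) := by
  have h0 := (h.mem_frontier_iff _ hs₀).1 hs₀'
  have hlt : ∀ s < s₀, q + s • a ∈ Metric.ball p r → q + s • a ∈ Ω := by
    intro s hs hsb
    rw [h.mem_iff _ hsb, ← h0]
    exact h.lt_of_lt hε haν ha hs hsb hs₀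
  refine integral_line_eq hΩ hφ hsupp (h.one_le_norm haν) q s₀ hlt ?_ ?_
  · intro s hs hsb hmem
    rw [h.mem_iff _ hsb] at hmem
    rcases hs.eq_or_lt with rfl | hs
    · exact absurd h0 hmem.ne
    · have := h.lt_of_lt hε haν ha hs hs₀ hsb
      linarith
  · have hline : Continuous fun s : ℝ => q + s • a := by fun_prop
    have h1 : ContinuousWithinAt φ (closure Ω) (q + s₀ • a) :=
      hφ.continuousOn _ (frontier_subset_closure hs₀')
    refine h1.tendsto.comp (tendsto_nhdsWithin_iff.2
      ⟨hline.continuousAt.continuousWithinAt, ?_⟩)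
    filter_upwards [self_mem_nhdsWithin, mem_nhdsWithin_of_mem_nhds
      (hline.continuousAt.preimage_mem_nhds (Metric.isOpen_ball.mem_nhds hs₀))] with s hs hsb
    rcases (show s ≤ s₀ from hs).eq_or_lt with rfl | hs
    · exact frontier_subset_closure hs₀'
    · exact subset_closure (hlt s hs hsb)

theorem IsNormalChart.continuousOn (h : IsNormalChart Ω p ν r ε ρ) :
    ContinuousOn ρ (Metric.ball p r) := by
  have : LipschitzOnWith (1 + |ε|).toNNReal ρ (Metric.ball p r) := by
    refine LipschitzOnWith.of_dist_le_mul fun x hx y hy => ?_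
    rw [Real.dist_eq, dist_eq_norm, Real.coe_toNNReal _ (by positivity)]
    have h1 := h.approx x hx y hy
    have h2 : |inner ℝ ν (x - y)| ≤ ‖x - y‖ := by
      simpa [h.norm_normal] using abs_real_inner_le_norm ν (x - y)
    have h3 : |ρ x - ρ y| ≤ |ρ x - ρ y - inner ℝ ν (x - y)| + |inner ℝ ν (x - y)| := by
      simpa using abs_add_le (ρ x - ρ y - inner ℝ ν (x - y)) (inner ℝ ν (x - y))
    nlinarith [mul_le_mul_of_nonneg_right (le_abs_self ε) (norm_nonneg (x - y))]
  exact this.continuousOn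

/-- The part of the line in the ball is an interval on which `ρ` is continuous and has no zero, so
it lies entirely inside or entirely outside `Ω`. -/
theorem IsNormalChart.integral_line_of_forall_notMem_frontier [CompleteSpace F]
    (h : IsNormalChart Ω p ν r ε ρ) (hΩ : IsOpen Ω)
    (haν : inner ℝ ν a = 1) (hφ : IsC1UpToBoundary Ω φ)
    (hsupp : tsupport φ ⊆ Metric.ball p r) {q : E}
    (hq : ∀ s : ℝ, q + s • a ∈ Metric.ball p r → q + s • a ∉ frontier Ω) :
    ∫ s : ℝ, Ω.indicator (fun x => fderiv ℝ φ x a) (q + s • a) = 0 := by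
  have hline : Continuous fun s : ℝ => q + s • a := by fun_prop
  have ha1 := h.one_le_norm haν
  have hfar : ∀ s : ℝ, r + ‖q - p‖ ≤ |s| → q + s • a ∉ Metric.ball p r := by
    exact fun s hs hsb => absurd (abs_lt_of_line_mem_ball ha1 hsb) (not_lt.2 hs)
  have hzero : ∀ s : ℝ, q + s • a ∉ Metric.ball p r → φ (q + s • a) = 0 := fun s hs =>
    image_eq_zero_of_notMem_tsupport fun h' => hs (hsupp h')
  have hcont : ∀ s : ℝ, q + s • a ∉ Metric.ball p r →
      ContinuousWithinAt (fun s : ℝ => φ (q + s • a)) (Iic s) s := by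
    intro s hs
    have h1 : φ =ᶠ[nhds (q + s • a)] fun _ => 0 :=
      notMem_tsupport_iff_eventuallyEq.1 fun h' => hs (hsupp h')
    have h2 : (fun s : ℝ => φ (q + s • a)) =ᶠ[nhds s] fun _ => 0 :=
      hline.continuousAt.eventually h1
    exact (continuousAt_const.congr h2.symm).continuousWithinAt
  set R := r + ‖q - p‖ with hR
  have hRpos : 0 < R := add_pos_of_pos_of_nonneg h.pos (norm_nonneg _)
  set I : Set ℝ := {s | q + s • a ∈ Metric.ball p r} with hI
  have hIconv : Convex ℝ I := by
    intro s hs t ht c d hc hd hcd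
    have h1 := convex_ball p r hs ht hc hd hcd
    have h2 : c • (q + s • a) + d • (q + t • a) = q + (c • s + d • t) • a := by
      have : q = (c + d) • q := by rw [hcd, one_smul]
      nth_rewrite 3 [this]
      module
    rwa [h2] at h1
  have hIρ : ContinuousOn (fun s : ℝ => ρ (q + s • a)) I :=
    h.continuousOn.comp hline.continuousOn fun s hs => hs
  have hsign : (∀ s ∈ I, q + s • a ∈ Ω) ∨ ∀ s ∈ I, q + s • a ∉ Ω := by
    by_contra! hcon
    obtain ⟨⟨s, hs, hsΩ⟩, t, ht, htΩ⟩ := hcon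
    rw [h.mem_iff _ hs, not_lt] at hsΩ
    rw [h.mem_iff _ ht] at htΩ
    obtain ⟨u, hu, hu0⟩ := hIconv.isPreconnected.intermediate_value ht hs hIρ
      (⟨htΩ.le, hsΩ⟩ : (0 : ℝ) ∈ Icc _ _)
    exact hq u hu ((h.mem_frontier_iff _ hu).2 hu0)
  -- In either case the exit parameter can be placed at `R` or `-R`, where the line is already
  -- outside the ball and `φ` vanishes.
  rcases hsign with hs | hs
  · have hR' : q + R • a ∉ Metric.ball p r := hfar R (le_abs_self R)
    rw [integral_line_eq hΩ hφ hsupp ha1 q R (fun s _ hsb => hs s hsb) ?_ (hcont R hR'),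
      hzero R hR']
    intro s hsR hsb
    exact absurd hsb (hfar s (hsR.trans (le_abs_self s)))
  · have hR' : q + (-R) • a ∉ Metric.ball p r := hfar (-R) (by rw [abs_neg]; exact le_abs_self R)
    rw [integral_line_eq hΩ hφ hsupp ha1 q (-R) ?_ (fun s _ hsb => hs s hsb) (hcont (-R) hR'),
      hzero (-R) hR']
    intro s hsR hsb
    refine absurd hsb (hfar s ?_)
    rw [abs_of_neg (by linarith)]
    linarith

end Line

/-! ### Integration over a family of parallel oblique lines. -/

section Fubini

variable {E F : Type*} [NormedAddCommGroup E] [InnerProductSpace ℝ E] [FiniteDimensional ℝ E]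
  [MeasurableSpace E] [BorelSpace E] [NormedAddCommGroup F] [NormedSpace ℝ F]

/-- Orthogonal coordinates along `ν` and `ν^⊥` are composed with the shear `(s, y) ↦ (s, s e + y)`.
Because the direction `ν + e` has `ν`-component exactly `1`, no Jacobian factor appears. -/
theorem measurePreserving_line_param {ν : E} (hν : ‖ν‖ = 1) (p : E) (e : (ℝ ∙ ν)ᗮ) :
    MeasurePreserving (fun z : (ℝ ∙ ν)ᗮ × ℝ => p + z.1 + z.2 • (ν + e)) := by
  have h1 : MeasurePreserving ((Submodule.measurableEquivProd (ℝ ∙ ν) p).symm)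
      (volume : Measure ((ℝ ∙ ν) × (ℝ ∙ ν)ᗮ)) volume := by
    have := Submodule.measurePreserving_measurableEquivProd (ℝ ∙ ν) p
    rw [InnerProductSpace.euclideanHausdorffMeasure_eq_volume] at this
    exact this.symm
  have h2 : MeasurePreserving (Prod.map (LinearIsometryEquiv.toSpanUnitSingleton ν hν)
      (id : (ℝ ∙ ν)ᗮ → (ℝ ∙ ν)ᗮ)) volume volume :=
    (LinearIsometryEquiv.toSpanUnitSingleton ν hν).measurePreserving.prod (MeasurePreserving.id _)
  have h3 : MeasurePreserving (fun z : ℝ × (ℝ ∙ ν)ᗮ => (z.1, z.1 • e + z.2))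
      (volume.prod volume) (volume.prod volume) := by
    refine (MeasurePreserving.id (volume : Measure ℝ)).skew_product
      (g := fun s y => s • e + y) (by fun_prop) ?_
    exact ae_of_all _ fun s => map_add_left_eq_self volume (s • e)
  have h4 : MeasurePreserving (Prod.swap : (ℝ ∙ ν)ᗮ × ℝ → ℝ × (ℝ ∙ ν)ᗮ)
      (volume.prod volume) (volume.prod volume) := Measure.measurePreserving_swap
  refine (congrArg (fun f => MeasurePreserving f volume volume) ?_).mp
    (h1.comp (h2.comp (h3.comp h4)))
  funext z
  simp only [Function.comp, Prod.fst_swap, Prod.snd_swap, Prod.map, id,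
    Submodule.measurableEquivProd_symm_apply, vadd_eq_add,
    LinearIsometryEquiv.toSpanUnitSingleton_apply, Submodule.coe_add, Submodule.coe_smul]
  module

theorem integral_eq_integral_lines {ν : E} (hν : ‖ν‖ = 1) (p : E) (e : (ℝ ∙ ν)ᗮ) {ψ : E → F}
    (hψ : Integrable ψ) :
    ∫ x, ψ x = ∫ y : (ℝ ∙ ν)ᗮ, ∫ s : ℝ, ψ (p + y + s • (ν + e)) := by
  have hmp := measurePreserving_line_param hν p e
  have hinj : Function.Injective (fun z : (ℝ ∙ ν)ᗮ × ℝ => p + z.1 + z.2 • (ν + e)) := by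
    rintro ⟨y, s⟩ ⟨y', s'⟩ h
    have h0 : ∀ w : (ℝ ∙ ν)ᗮ, inner ℝ ν (w : E) = 0 := fun w =>
      Submodule.mem_orthogonal_singleton_iff_inner_right.1 w.2
    have hs : s = s' := by
      have := congrArg (fun x => inner ℝ ν (x - p)) h
      simpa [add_assoc, inner_add_right, inner_smul_right, h0, hν] using this
    subst hs
    have : (y : E) = y' := by simpa using h
    exact Prod.ext (Subtype.ext this) rfl
  have hemb : MeasurableEmbedding (fun z : (ℝ ∙ ν)ᗮ × ℝ => p + z.1 + z.2 • (ν + e)) :=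
    Continuous.measurableEmbedding (by fun_prop) hinj
  rw [← hmp.integral_comp hemb ψ]
  exact integral_prod _ ((hmp.integrable_comp_emb hemb).2 hψ)

end Fubini

/-! ### Hausdorff measure under bi-Lipschitz maps, and comparison of integrals. -/

section Lipschitz

variable {X Y : Type*} [EMetricSpace X] [MeasurableSpace X] [BorelSpace X]
  [EMetricSpace Y] [MeasurableSpace Y] [BorelSpace Y] {K : NNReal} {f : X → Y}

theorem LipschitzWith.euclideanHausdorffMeasure_image_le (hf : LipschitzWith K f) (d : ℕ)
    (s : Set X) : μHE[d] (f '' s) ≤ (K ^ d : NNReal) * μHE[d] s := by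
  have h := hf.hausdorffMeasure_image_le (d := d) (by positivity) s
  rw [ENNReal.rpow_natCast] at h
  simp only [Measure.euclideanHausdorffMeasure_def, Measure.smul_apply, ENNReal.smul_def,
    smul_eq_mul, ENNReal.coe_pow]
  rw [mul_left_comm]
  gcongr

theorem AntilipschitzWith.le_euclideanHausdorffMeasure_image (hf : AntilipschitzWith K f) (d : ℕ)
    (s : Set X) : μHE[d] s ≤ (K ^ d : NNReal) * μHE[d] (f '' s) := by
  have h := hf.le_hausdorffMeasure_image (d := d) (by positivity) s
  rw [ENNReal.rpow_natCast] at h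
  simp only [Measure.euclideanHausdorffMeasure_def, Measure.smul_apply, ENNReal.smul_def,
    smul_eq_mul, ENNReal.coe_pow]
  rw [mul_left_comm]
  gcongr

end Lipschitz

/-- Integrals against two nearly equal measures are close. -/
theorem norm_integral_sub_integral_le_of_measure_le {X F : Type*} [MeasurableSpace X]
    [NormedAddCommGroup F] [NormedSpace ℝ F] {m μ : Measure X} [IsFiniteMeasure m]
    {η : NNReal} (h1 : m ≤ (1 + η) • μ) (h2 : μ ≤ (1 + η) • m) {φ : X → F}
    (hφ : Integrable φ μ) :
    ‖∫ x, φ x ∂m - ∫ x, φ x ∂μ‖ ≤ 3 * η * ∫ x, ‖φ x‖ ∂μ := by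
  have hs : Integrable φ ((1 + η) • μ) := hφ.smul_measure_nnreal
  have hm : Integrable φ m := hs.mono_measure h1
  set κ := (1 + η) • μ - m with hκ
  -- The deficit `κ = (1 + η) μ - m` is a positive measure, and `∫ φ dm - ∫ φ dμ = η ∫ φ dμ - ∫ φ
  -- dκ`. The reverse comparison gives `∫ |φ| dκ ≤ 2η ∫ |φ| dμ`, whence the constant `3`.
  have hκm : κ + m = (1 + η) • μ := Measure.sub_add_cancel_of_le h1
  have hκint : Integrable φ κ := by
    refine hs.mono_measure ?_
    rw [← hκm]
    exact Measure.le_add_right le_rfl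
  have e1 : ∫ x, φ x ∂κ + ∫ x, φ x ∂m = (1 + (η : ℝ)) • ∫ x, φ x ∂μ := by
    rw [← integral_add_measure hκint hm, hκm, integral_smul_nnreal_measure]
    rfl
  have e2 : ∫ x, ‖φ x‖ ∂κ + ∫ x, ‖φ x‖ ∂m = (1 + (η : ℝ)) * ∫ x, ‖φ x‖ ∂μ := by
    rw [← integral_add_measure hκint.norm hm.norm, hκm, integral_smul_nnreal_measure]
    rfl
  have e3 : ∫ x, ‖φ x‖ ∂μ ≤ (1 + (η : ℝ)) * ∫ x, ‖φ x‖ ∂m := by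
    calc ∫ x, ‖φ x‖ ∂μ ≤ ∫ x, ‖φ x‖ ∂((1 + η) • m) :=
          integral_mono_measure h2 (ae_of_all _ fun x => norm_nonneg _) hm.norm.smul_measure_nnreal
      _ = _ := by rw [integral_smul_nnreal_measure]; rfl
  have e4 : ‖∫ x, φ x ∂κ‖ ≤ ∫ x, ‖φ x‖ ∂κ := norm_integral_le_integral_norm _
  have e5 : ∫ x, φ x ∂m - ∫ x, φ x ∂μ = (η : ℝ) • ∫ x, φ x ∂μ - ∫ x, φ x ∂κ := by
    have : ∫ x, φ x ∂m = (1 + (η : ℝ)) • ∫ x, φ x ∂μ - ∫ x, φ x ∂κ := by rw [← e1]; abel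
    rw [this]
    module
  have e6 : ‖∫ x, φ x ∂μ‖ ≤ ∫ x, ‖φ x‖ ∂μ := norm_integral_le_integral_norm _
  have hη : (0 : ℝ) ≤ η := η.2
  have hA : 0 ≤ ∫ x, ‖φ x‖ ∂μ := integral_nonneg fun _ => norm_nonneg _
  have hB : 0 ≤ ∫ x, ‖φ x‖ ∂m := integral_nonneg fun _ => norm_nonneg _
  rw [e5]
  refine (norm_sub_le _ _).trans ?_
  rw [norm_smul, Real.norm_of_nonneg hη]
  have e7 : ∫ x, ‖φ x‖ ∂m ≤ (1 + (η : ℝ)) * ∫ x, ‖φ x‖ ∂μ := by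
    have : 0 ≤ ∫ x, ‖φ x‖ ∂κ := integral_nonneg fun _ => norm_nonneg _
    linarith
  have e8 : (1 - (η : ℝ)) * ∫ x, ‖φ x‖ ∂μ ≤ ∫ x, ‖φ x‖ ∂m := by
    rcases le_or_gt (η : ℝ) 1 with hη1 | hη1
    · calc (1 - (η : ℝ)) * ∫ x, ‖φ x‖ ∂μ ≤ (1 - (η : ℝ)) * ((1 + (η : ℝ)) * ∫ x, ‖φ x‖ ∂m) := by
            gcongr
        _ ≤ _ := by nlinarith [mul_nonneg (mul_nonneg hη hη) hB]
    · nlinarith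
  have := mul_le_mul_of_nonneg_left e6 hη
  linarith

/-! ### Oblique projections onto the tangent hyperplane. -/

section Oblique

variable {E : Type*} [NormedAddCommGroup E] [InnerProductSpace ℝ E]

/-- The affine projection along `ν + e` of a point onto the hyperplane through `p` orthogonal
to `ν`. -/
def obliqueProj {ν : E} (hν : ‖ν‖ = 1) (p : E) (e : (ℝ ∙ ν)ᗮ) (x : E) : (ℝ ∙ ν)ᗮ :=
  ⟨x - p - inner ℝ ν (x - p) • (ν + e), by
    rw [Submodule.mem_orthogonal_singleton_iff_inner_right, inner_sub_right, inner_smul_right,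
      inner_add_right, Submodule.mem_orthogonal_singleton_iff_inner_right.1 e.2,
      real_inner_self_eq_norm_sq, hν]
    ring⟩

variable {ν : E} (hν : ‖ν‖ = 1) (p : E) (e : (ℝ ∙ ν)ᗮ)

theorem continuous_obliqueProj : Continuous (obliqueProj hν p e) := by
  unfold obliqueProj
  fun_prop

theorem add_obliqueProj_add (x : E) :
    p + obliqueProj hν p e x + inner ℝ ν (x - p) • (ν + e) = x := by
  simp only [obliqueProj]
  abel

theorem obliqueProj_add (y : (ℝ ∙ ν)ᗮ) (s : ℝ) :
    obliqueProj hν p e (p + y + s • (ν + e)) = y := by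
  have h0 : ∀ w : (ℝ ∙ ν)ᗮ, inner ℝ ν (w : E) = 0 := fun w =>
      Submodule.mem_orthogonal_singleton_iff_inner_right.1 w.2
  have : inner ℝ ν (p + y + s • (ν + e) - p : E) = s := by
    have e1 : (p + y + s • (ν + e) - p : E) = y + s • (ν + e) := by abel
    rw [e1, inner_add_right, inner_smul_right, inner_add_right, h0, h0,
      real_inner_self_eq_norm_sq, hν]
    ring
  ext
  simp only [obliqueProj, this]
  abel

theorem inner_add_orthogonal {ν : E} (hν : ‖ν‖ = 1) (e : (ℝ ∙ ν)ᗮ) : inner ℝ ν (ν + e) = 1 := by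
  rw [inner_add_right, Submodule.mem_orthogonal_singleton_iff_inner_right.1 e.2,
    real_inner_self_eq_norm_sq, hν]
  norm_num

theorem norm_add_orthogonal_le {ν : E} (hν : ‖ν‖ = 1) {e : (ℝ ∙ ν)ᗮ} (he : ‖e‖ ≤ 1) : ‖ν + e‖ ≤ 2 := by
  have := norm_add_le ν (e : E)
  rw [hν] at this
  have h2 : ‖(e : E)‖ ≤ 1 := he
  linarith

end Oblique

/-! ### Surface measure compared with projected Lebesgue measure. -/

section ChartMeasure

variable {n : ℕ} {Ω : Set (EuclideanSpace ℝ (Fin n))} {p ν : EuclideanSpace ℝ (Fin n)} {r ε : ℝ}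
  {ρ : EuclideanSpace ℝ (Fin n) → ℝ}

theorem measurableSet_frontier_inter_ball :
    MeasurableSet (frontier Ω ∩ Metric.ball p r) :=
  isClosed_frontier.measurableSet.inter Metric.isOpen_ball.measurableSet

/-- For two points of `∂Ω` the function `ρ` takes the same value, so `|⟪ν, x - y⟫| ≤ ε ‖x - y‖`. The
projection alters `x - y` only by this number times `ν + e`, a vector of length at most `2`. -/
theorem IsNormalChart.abs_norm_obliqueProj_sub_le (h : IsNormalChart Ω p ν r ε ρ)
    {e : (ℝ ∙ ν)ᗮ} (he : ‖e‖ ≤ 1)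
    (x y : ↥(frontier Ω ∩ Metric.ball p r)) :
    |‖obliqueProj h.norm_normal p e x - obliqueProj h.norm_normal p e y‖ - dist x y|
      ≤ 2 * ε * dist x y := by
  have h1 := h.approx x x.2.2 y y.2.2
  rw [(h.mem_frontier_iff x x.2.2).1 x.2.1, (h.mem_frontier_iff y y.2.2).1 y.2.1, sub_self,
    zero_sub, abs_neg] at h1
  have e1 : ((obliqueProj h.norm_normal p e x - obliqueProj h.norm_normal p e y : (ℝ ∙ ν)ᗮ) :
      EuclideanSpace ℝ (Fin n)) = (x - y : EuclideanSpace ℝ (Fin n))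
        - inner ℝ ν (x - y : EuclideanSpace ℝ (Fin n)) • (ν + e) := by
    simp only [obliqueProj, Submodule.coe_sub, inner_sub_right]
    module
  have h2 : ‖inner ℝ ν (x - y : EuclideanSpace ℝ (Fin n)) • (ν + (e : EuclideanSpace ℝ (Fin n)))‖
      ≤ 2 * ε * ‖(x - y : EuclideanSpace ℝ (Fin n))‖ := by
    rw [norm_smul, Real.norm_eq_abs]
    have := norm_add_orthogonal_le h.norm_normal he
    nlinarith [mul_le_mul h1 this (norm_nonneg _) ((abs_nonneg _).trans h1)]
  change |‖((obliqueProj h.norm_normal p e x - obliqueProj h.norm_normal p e y : (ℝ ∙ ν)ᗮ) :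
    EuclideanSpace ℝ (Fin n))‖ - _| ≤ _
  rw [e1, Subtype.dist_eq, dist_eq_norm]
  refine (abs_norm_sub_norm_le _ _).trans ?_
  rwa [sub_sub_cancel_left, norm_neg]

theorem IsNormalChart.lipschitzWith_obliqueProj (h : IsNormalChart Ω p ν r ε ρ)
    {e : (ℝ ∙ ν)ᗮ} (he : ‖e‖ ≤ 1) {K : NNReal} (hK : 1 + 2 * ε ≤ K) :
    LipschitzWith K fun x : ↥(frontier Ω ∩ Metric.ball p r) =>
      obliqueProj h.norm_normal p e x := by
  refine LipschitzWith.of_dist_le_mul fun x y => ?_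
  have := (abs_le.1 (h.abs_norm_obliqueProj_sub_le he x y)).2
  rw [dist_eq_norm]
  nlinarith [dist_nonneg (x := x) (y := y)]

theorem IsNormalChart.antilipschitzWith_obliqueProj (h : IsNormalChart Ω p ν r ε ρ)
    {e : (ℝ ∙ ν)ᗮ} (he : ‖e‖ ≤ 1) {K : NNReal} (hK : 1 ≤ K * (1 - 2 * ε)) :
    AntilipschitzWith K fun x : ↥(frontier Ω ∩ Metric.ball p r) =>
      obliqueProj h.norm_normal p e x := by
  refine AntilipschitzWith.of_le_mul_dist fun x y => ?_
  have := (abs_le.1 (h.abs_norm_obliqueProj_sub_le he x y)).1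
  rw [dist_eq_norm]
  have h1 : (1 - 2 * ε) * dist x y ≤
    ‖obliqueProj h.norm_normal p e x - obliqueProj h.norm_normal p e y‖ := by linarith
  calc dist x y ≤ (K * (1 - 2 * ε)) * dist x y := le_mul_of_one_le_left dist_nonneg hK
    _ = K * ((1 - 2 * ε) * dist x y) := by ring
    _ ≤ _ := by gcongr

/-- The existence of a unit vector forces `n ≥ 1`, so the truncated subtraction is a genuine one. -/
theorem finrank_orthogonal_span_unit (hν : ‖ν‖ = 1) :
    Module.finrank ℝ (ℝ ∙ ν)ᗮ = n - 1 := by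
  have h1 := Submodule.finrank_add_finrank_orthogonal (ℝ ∙ ν)
  have h2 : Module.finrank ℝ (ℝ ∙ ν) = 1 :=
    finrank_span_singleton (by rintro rfl; simp at hν)
  rw [h2, finrank_euclideanSpace_fin] at h1
  omega

theorem IsNormalChart.injective_obliqueProj (h : IsNormalChart Ω p ν r ε ρ) (hε : ε ≤ 1 / 4)
    {e : (ℝ ∙ ν)ᗮ} (he : ‖e‖ ≤ 1) :
    Function.Injective fun x : ↥(frontier Ω ∩ Metric.ball p r) =>
      obliqueProj h.norm_normal p e x :=
  (h.antilipschitzWith_obliqueProj he (K := 2) (by push_cast; linarith)).injective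

/-- An injective Borel map on a standard Borel space is a measurable embedding, by the Lusin–Souslin
theorem. -/
theorem IsNormalChart.measurableEmbedding_obliqueProj (h : IsNormalChart Ω p ν r ε ρ)
    (hε : ε ≤ 1 / 4) {e : (ℝ ∙ ν)ᗮ} (he : ‖e‖ ≤ 1) :
    MeasurableEmbedding fun x : ↥(frontier Ω ∩ Metric.ball p r) =>
      obliqueProj h.norm_normal p e x :=
  haveI := (measurableSet_frontier_inter_ball (Ω := Ω) (p := p) (r := r)).standardBorel
  Measurable.measurableEmbedding
    ((continuous_obliqueProj _ p e).measurable.comp measurable_subtype_coe)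
    (h.injective_obliqueProj hε he)

/-- The measure on the boundary obtained by an oblique projection to a hyperplane. -/
def obliqueMeasure (Ω : Set (EuclideanSpace ℝ (Fin n))) (r : ℝ) (hν : ‖ν‖ = 1)
    (p : EuclideanSpace ℝ (Fin n)) (e : (ℝ ∙ ν)ᗮ) :
    Measure ↥(frontier Ω ∩ Metric.ball p r) :=
  Measure.comap (fun x : ↥(frontier Ω ∩ Metric.ball p r) => obliqueProj hν p e x) volume

theorem IsNormalChart.obliqueMeasure_apply (h : IsNormalChart Ω p ν r ε ρ)
    (hε : ε ≤ 1 / 4) {e : (ℝ ∙ ν)ᗮ} (he : ‖e‖ ≤ 1) (A : Set ↥(frontier Ω ∩ Metric.ball p r)) :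
    obliqueMeasure Ω r h.norm_normal p e A =
      μHE[n - 1] ((fun x : ↥(frontier Ω ∩ Metric.ball p r) =>
        obliqueProj h.norm_normal p e x) '' A) := by
  rw [obliqueMeasure, (h.measurableEmbedding_obliqueProj hε he).comap_apply,
    ← finrank_orthogonal_span_unit h.norm_normal,
    InnerProductSpace.euclideanHausdorffMeasure_eq_volume]

/-- Together with `IsNormalChart.le_obliqueMeasure` this replaces the exact area formula: on `ν^⊥`
Lebesgue measure is the Hausdorff measure of dimension `n - 1`, so the bi-Lipschitz constants of the
projection compare the two measures on `∂Ω`. -/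
theorem IsNormalChart.obliqueMeasure_le (h : IsNormalChart Ω p ν r ε ρ)
    (hε : ε ≤ 1 / 4) {e : (ℝ ∙ ν)ᗮ} (he : ‖e‖ ≤ 1) {K : NNReal} (hK : 1 + 2 * ε ≤ K) :
    obliqueMeasure Ω r h.norm_normal p e ≤ (K ^ (n - 1)) • μHE[n - 1] := by
  refine Measure.le_iff.2 fun A _ => ?_
  rw [h.obliqueMeasure_apply hε he]
  exact (h.lipschitzWith_obliqueProj he hK).euclideanHausdorffMeasure_image_le (n - 1) A

theorem IsNormalChart.le_obliqueMeasure (h : IsNormalChart Ω p ν r ε ρ)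
    (hε : ε ≤ 1 / 4) {e : (ℝ ∙ ν)ᗮ} (he : ‖e‖ ≤ 1) {K : NNReal} (hK : 1 ≤ K * (1 - 2 * ε)) :
    μHE[n - 1] ≤ (K ^ (n - 1)) • obliqueMeasure Ω r h.norm_normal p e := by
  refine Measure.le_iff.2 fun A _ => ?_
  rw [Measure.smul_apply, h.obliqueMeasure_apply hε he]
  exact (h.antilipschitzWith_obliqueProj he hK).le_euclideanHausdorffMeasure_image (n - 1) A

theorem IsNormalChart.isFiniteMeasure_obliqueMeasure (h : IsNormalChart Ω p ν r ε ρ)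
    (hε : ε ≤ 1 / 4) {e : (ℝ ∙ ν)ᗮ} (he : ‖e‖ ≤ 1) :
    IsFiniteMeasure (obliqueMeasure Ω r h.norm_normal p e) := by
  refine ⟨?_⟩
  rw [obliqueMeasure, (h.measurableEmbedding_obliqueProj hε he).comap_apply]
  refine Bornology.IsBounded.measure_lt_top ?_
  refine (h.lipschitzWith_obliqueProj he (K := 2) (by push_cast; linarith)).isBounded_image ?_
  rw [Metric.isBounded_iff]
  refine ⟨r + r, fun x _ y _ => ?_⟩
  exact ((dist_triangle_right (x : EuclideanSpace ℝ (Fin n)) y p).trans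
    (add_le_add (Metric.mem_ball.1 x.2.2).le (Metric.mem_ball.1 y.2.2).le))

/-- The boundary patch is controlled by its orthogonal projection (`e = 0`), a bounded subset of a
hyperplane. This is where finiteness of the area of `∂Ω` comes from; compactness then makes it
global. -/
theorem IsNormalChart.isFiniteMeasure_euclideanHausdorffMeasure (h : IsNormalChart Ω p ν r ε ρ)
    (hε : ε ≤ 1 / 4) :
    IsFiniteMeasure (μHE[n - 1] : Measure ↥(frontier Ω ∩ Metric.ball p r)) := by
  have he : ‖(0 : (ℝ ∙ ν)ᗮ)‖ ≤ 1 := by simp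
  have := h.isFiniteMeasure_obliqueMeasure hε he
  exact isFiniteMeasure_of_le _
    (h.le_obliqueMeasure hε he (K := 2) (by push_cast; linarith))

/-- A bounded function with support in `ball p r` has the same integral over the whole boundary as
over its part in the ball. -/
theorem integral_surfaceMeasure_eq {F : Type*} [NormedAddCommGroup F] [NormedSpace ℝ F]
    {g : EuclideanSpace ℝ (Fin n) → F} (hg : ∀ x ∉ Metric.ball p r, g x = 0) :
    ∫ x, g x ∂(surfaceMeasure Ω) =
      ∫ x : ↥(frontier Ω ∩ Metric.ball p r), g x ∂μHE[n - 1] := by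
  have hm := measurableSet_frontier_inter_ball (Ω := Ω) (p := p) (r := r)
  have h1 := (isometry_subtype_coe (s := frontier Ω ∩ Metric.ball p r)).map_euclideanHausdorffMeasure
    (d := n - 1)
  rw [Subtype.range_coe] at h1
  rw [surfaceMeasure, ← (MeasurableEmbedding.subtype_coe hm).integral_map, h1]
  refine setIntegral_eq_of_subset_of_forall_sdiff_eq_zero isClosed_frontier.measurableSet
    inter_subset_left fun x hx => hg x fun hxb => hx.2 ⟨hx.1, hxb⟩

theorem IsNormalChart.surfaceMeasure_ball_lt_top (h : IsNormalChart Ω p ν r ε ρ)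
    (hε : ε ≤ 1 / 4) : surfaceMeasure Ω (Metric.ball p r) < ⊤ := by
  have := h.isFiniteMeasure_euclideanHausdorffMeasure hε
  have h1 := (isometry_subtype_coe (s := frontier Ω ∩ Metric.ball p r)).euclideanHausdorffMeasure_image
    (d := n - 1) univ
  rw [image_univ, Subtype.range_coe] at h1
  rw [surfaceMeasure, Measure.restrict_apply Metric.isOpen_ball.measurableSet, inter_comm, h1]
  exact measure_lt_top _ _

end ChartMeasure

/-! ### Gauss' formula in a chart, and finiteness of the surface measure. -/

section LocalGauss

variable {n : ℕ} {Ω : Set (EuclideanSpace ℝ (Fin n))} {p ν : EuclideanSpace ℝ (Fin n)} {r ε : ℝ}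
  {ρ : EuclideanSpace ℝ (Fin n) → ℝ} {F : Type*} [NormedAddCommGroup F] [NormedSpace ℝ F]
  {φ : EuclideanSpace ℝ (Fin n) → F}

theorem IsC1UpToBoundary.integrableOn_fderiv (hΩ : IsBoundedSmoothDomain Ω)
    (hφ : IsC1UpToBoundary Ω φ) (d : EuclideanSpace ℝ (Fin n)) :
    IntegrableOn (fun x => fderiv ℝ φ x d) Ω := by
  obtain ⟨C, hC⟩ := hφ.bounded
  have : IsFiniteMeasure (volume.restrict Ω) := isFiniteMeasure_restrict.2
    hΩ.isBounded.measure_lt_top.ne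
  refine Integrable.of_bound (C := C * ‖d‖) ?_ ?_
  · exact ((hφ.contDiffOn.continuousOn_fderiv_of_isOpen hΩ.isOpen (by simp)).clm_apply
      continuousOn_const).aestronglyMeasurable hΩ.isOpen.measurableSet
  · refine (ae_restrict_iff' hΩ.isOpen.measurableSet).2 (ae_of_all _ fun x hx => ?_)
    exact (ContinuousLinearMap.le_opNorm _ _).trans
      (mul_le_mul_of_nonneg_right (hC x hx) (norm_nonneg d))

/-- By Fubini's theorem along the lines parallel to `ν + e`, a line that crosses `∂Ω` in the ball
contributes the value of `φ` at the crossing point, and every other line contributes `0`. What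
remains is an integral over the image of the projection. -/
theorem IsNormalChart.integral_fderiv_eq [CompleteSpace F] (hΩ : IsBoundedSmoothDomain Ω)
    (h : IsNormalChart Ω p ν r ε ρ)
    (hε : ε ≤ 1 / 4) {e : (ℝ ∙ ν)ᗮ} (he : ‖e‖ ≤ 1) (hφ : IsC1UpToBoundary Ω φ)
    (hsupp : tsupport φ ⊆ Metric.ball p r) :
    ∫ x in Ω, fderiv ℝ φ x (ν + e) = ∫ x, φ x ∂(obliqueMeasure Ω r h.norm_normal p e) := by
  have hint := hφ.integrableOn_fderiv hΩ (ν + e)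
  have haν := inner_add_orthogonal h.norm_normal e
  have ha := norm_add_orthogonal_le h.norm_normal he
  have hemb := h.measurableEmbedding_obliqueProj hε he
  rw [← integral_indicator hΩ.isOpen.measurableSet,
    integral_eq_integral_lines h.norm_normal p e
      ((integrable_indicator_iff hΩ.isOpen.measurableSet).2 hint)]
  set G : (ℝ ∙ ν)ᗮ → F := fun y => ∫ s : ℝ, Ω.indicator
    (fun x => fderiv ℝ φ x (ν + e)) (p + y + s • (ν + e)) with hG
  have hG0 : ∀ y ∉ range (fun x : ↥(frontier Ω ∩ Metric.ball p r) =>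
      obliqueProj h.norm_normal p e x), G y = 0 := by
    intro y hy
    refine h.integral_line_of_forall_notMem_frontier hΩ.isOpen haν hφ hsupp fun s hsb hsf => ?_
    exact hy ⟨⟨_, hsf, hsb⟩, obliqueProj_add h.norm_normal p e y s⟩
  have hG1 : ∀ x : ↥(frontier Ω ∩ Metric.ball p r),
      G (obliqueProj h.norm_normal p e x) = φ x := by
    intro x
    have hx := add_obliqueProj_add h.norm_normal p e (x : EuclideanSpace ℝ (Fin n))
    have := h.integral_line_of_mem_frontier hΩ.isOpen hε haν ha hφ hsupp
      (q := p + obliqueProj h.norm_normal p e x)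
      (s₀ := inner ℝ ν ((x : EuclideanSpace ℝ (Fin n)) - p))
      (by rw [hx]; exact x.2.2) (by rw [hx]; exact x.2.1)
    rwa [hx] at this
  rw [← setIntegral_eq_integral_of_forall_compl_eq_zero hG0, ← hemb.map_comap, hemb.integral_map]
  exact integral_congr_ae (ae_of_all _ hG1)

theorem IsC1UpToBoundary.exists_bound (hΩ : IsBoundedSmoothDomain Ω)
    (hφ : IsC1UpToBoundary Ω φ) : ∃ C, ∀ x ∈ closure Ω, ‖φ x‖ ≤ C :=
  hΩ.isBounded.isCompact_closure.exists_bound_of_continuousOn hφ.continuousOn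

theorem IsBoundedSmoothDomain.isCompact_frontier (hΩ : IsBoundedSmoothDomain Ω) :
    IsCompact (frontier Ω) :=
  hΩ.isBounded.isCompact_closure.of_isClosed_subset isClosed_frontier frontier_subset_closure

theorem IsBoundedSmoothDomain.isFiniteMeasure_surfaceMeasure (hΩ : IsBoundedSmoothDomain Ω) :
    IsFiniteMeasure (surfaceMeasure Ω) := by
  have h1 : ∀ p ∈ frontier Ω, ∃ U ∈ nhdsWithin p (frontier Ω), surfaceMeasure Ω U < ⊤ := by
    intro p hp
    obtain ⟨r, ρ, h, -⟩ := hΩ.exists_isNormalChart hp (ε := 1 / 4) (by norm_num) (by norm_num)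
    exact ⟨_, mem_nhdsWithin_of_mem_nhds (Metric.ball_mem_nhds p h.pos),
      h.surfaceMeasure_ball_lt_top le_rfl⟩
  have h2 : surfaceMeasure Ω (frontier Ω) < ⊤ :=
    hΩ.isCompact_frontier.measure_lt_top_of_nhdsWithin h1
  refine ⟨?_⟩
  rw [surfaceMeasure, Measure.restrict_apply_univ]
  rwa [surfaceMeasure, Measure.restrict_apply_self] at h2

theorem IsBoundedSmoothDomain.integrable_surfaceMeasure (hΩ : IsBoundedSmoothDomain Ω)
    {F : Type*} [NormedAddCommGroup F] {φ : EuclideanSpace ℝ (Fin n) → F}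
    (hφ : ContinuousOn φ (frontier Ω)) : Integrable φ (surfaceMeasure Ω) := by
  have := hΩ.isFiniteMeasure_surfaceMeasure
  obtain ⟨C, hC⟩ := hΩ.isCompact_frontier.exists_bound_of_continuousOn hφ
  refine Integrable.of_bound (C := C) (hφ.aestronglyMeasurable isClosed_frontier.measurableSet) ?_
  exact (ae_restrict_iff' isClosed_frontier.measurableSet).2 (ae_of_all _ hC)

end LocalGauss

/-! ### Gauss' theorem: local approximation and partition of unity. -/

section Gauss

variable {n : ℕ} {Ω : Set (EuclideanSpace ℝ (Fin n))} {p ν : EuclideanSpace ℝ (Fin n)} {r ε : ℝ}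
  {ρ : EuclideanSpace ℝ (Fin n) → ℝ} {F : Type*} [NormedAddCommGroup F] [NormedSpace ℝ F]
  {φ : EuclideanSpace ℝ (Fin n) → F}

/-- The choice `K = (1 - 2ε)⁻¹` serves as constant in both directions, since `(1 + 2ε)(1 - 2ε) ≤ 1`,
and `K ^ k` tends to `1` with `ε`. -/
theorem exists_small_distortion (k : ℕ) {η : ℝ} (hη : 0 < η) :
    ∃ ε > 0, ε ≤ 1 / 4 ∧ ε ≤ η ∧ ∃ K : NNReal, 1 + 2 * ε ≤ K ∧ 1 ≤ K * (1 - 2 * ε) ∧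
      (K : ℝ) ^ k ≤ 1 + η := by
  have hc : ContinuousAt (fun ε : ℝ => ((1 - 2 * ε)⁻¹) ^ k) 0 :=
    ((continuousAt_const.sub (continuousAt_const.mul continuousAt_id)).inv₀ (by simp)).pow k
  have h1 : ∀ᶠ ε in nhdsWithin (0 : ℝ) (Ioi 0), ((1 - 2 * ε)⁻¹) ^ k < 1 + η :=
    (hc.mono_left nhdsWithin_le_nhds).eventually (gt_mem_nhds (by simpa using hη))
  have h2 : ∀ᶠ ε in nhdsWithin (0 : ℝ) (Ioi 0), ε ∈ Ioo 0 (min (1 / 4) η) :=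
    Ioo_mem_nhdsGT (by positivity)
  obtain ⟨ε, hε1, hε0, hε2⟩ := (h1.and h2).exists
  have h4 : ε < 1 / 4 := hε2.trans_le (min_le_left _ _)
  have hpos : 0 < 1 - 2 * ε := by linarith
  refine ⟨ε, hε0, h4.le, (hε2.trans_le (min_le_right _ _)).le,
    ⟨(1 - 2 * ε)⁻¹, by positivity⟩, ?_, ?_, ?_⟩
  · change 1 + 2 * ε ≤ (1 - 2 * ε)⁻¹
    rw [le_inv_comm₀ (by linarith) hpos, ← one_div, le_div_iff₀ (by linarith)]
    nlinarith [sq_nonneg ε]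
  · change 1 ≤ (1 - 2 * ε)⁻¹ * (1 - 2 * ε)
    rw [inv_mul_cancel₀ hpos.ne']
  · exact hε1.le

theorem IsNormalChart.norm_integral_fderiv_sub_le [CompleteSpace F] (hΩ : IsBoundedSmoothDomain Ω)
    (h : IsNormalChart Ω p ν r ε ρ) (hε : ε ≤ 1 / 4) {K η : NNReal} (hK1 : 1 + 2 * ε ≤ K)
    (hK2 : 1 ≤ K * (1 - 2 * ε)) (hKη : K ^ (n - 1) ≤ 1 + η)
    {e : (ℝ ∙ ν)ᗮ} (he : ‖e‖ ≤ 1) (hφ : IsC1UpToBoundary Ω φ)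
    (hsupp : tsupport φ ⊆ Metric.ball p r) :
    ‖(∫ x in Ω, fderiv ℝ φ x (ν + e)) - ∫ x, φ x ∂(surfaceMeasure Ω)‖ ≤
      3 * η * ∫ x, ‖φ x‖ ∂(surfaceMeasure Ω) := by
  have hz : ∀ x ∉ Metric.ball p r, φ x = 0 := fun x hx =>
    image_eq_zero_of_notMem_tsupport fun h' => hx (hsupp h')
  rw [h.integral_fderiv_eq hΩ hε he hφ hsupp, integral_surfaceMeasure_eq hz,
    integral_surfaceMeasure_eq (g := fun x => ‖φ x‖) fun x hx => by rw [hz x hx, norm_zero]]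
  have := h.isFiniteMeasure_obliqueMeasure hε he
  have := h.isFiniteMeasure_euclideanHausdorffMeasure hε
  have hmono : ∀ m : Measure ↥(frontier Ω ∩ Metric.ball p r),
      (K ^ (n - 1)) • m ≤ (1 + η) • m := fun m => by
    refine Measure.le_iff.2 fun A _ => ?_
    simp only [Measure.smul_apply, ENNReal.smul_def, smul_eq_mul]
    gcongr
  refine norm_integral_sub_integral_le_of_measure_le
    ((h.obliqueMeasure_le hε he hK1).trans (hmono _))
    ((h.le_obliqueMeasure hε he hK2).trans (hmono _)) ?_
  obtain ⟨C, hC⟩ := hφ.exists_bound hΩ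
  refine Integrable.of_bound (C := C) ?_ (ae_of_all _ fun x => hC x
    (frontier_subset_closure x.2.1))
  have hcont : Continuous fun x : ↥(frontier Ω ∩ Metric.ball p r) => φ x :=
    hφ.continuousOn.comp_continuous continuous_subtype_val
      fun x => frontier_subset_closure x.2.1
  exact hcont.aestronglyMeasurable

/-- With `t = ⟪ν, d⟫` and `e = d - tν`, one has `d = (t - 1) ν + (ν + e)`. The two directions `ν`
and `ν + e` both give nearly `∫ φ dS`, so `d` gives nearly `t ∫ φ dS`, and `t` is close to `⟪ν(x),
d⟫` on the patch. The radius depends neither on `φ` nor on `d`. -/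
theorem IsBoundedSmoothDomain.exists_local_gauss [CompleteSpace F] (hΩ : IsBoundedSmoothDomain Ω)
    (hp : p ∈ frontier Ω) {η : ℝ} (hη : 0 < η) :
    ∃ r > 0, ∀ φ : EuclideanSpace ℝ (Fin n) → F, IsC1UpToBoundary Ω φ →
      tsupport φ ⊆ Metric.ball p r → ∀ d : EuclideanSpace ℝ (Fin n), ‖d‖ ≤ 1 →
      ‖(∫ x in Ω, fderiv ℝ φ x d) -
        ∫ x, inner ℝ (outerNormal Ω x) d • φ x ∂(surfaceMeasure Ω)‖ ≤
      η * ∫ x, ‖φ x‖ ∂(surfaceMeasure Ω) := by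
  -- The comparison error `3η/20` enters at most three times, as `|t - 1| ≤ 2`, and the variation of
  -- the normal adds `ε ≤ η/20`: in all at most `η/2`.
  obtain ⟨ε, hε0, hε, hεη, K, hK1, hK2, hKη⟩ := exists_small_distortion (n - 1)
    (η := η / 20) (by positivity)
  obtain ⟨r, ρ, h, hn⟩ := hΩ.exists_isNormalChart hp hε0 (by linarith)
  set ν := outerNormal Ω p with hν
  refine ⟨r, h.pos, fun φ hφ hsupp d hd => ?_⟩
  let η' : NNReal := ⟨η / 20, by positivity⟩
  have hloc : ∀ e : (ℝ ∙ ν)ᗮ, ‖e‖ ≤ 1 → ‖(∫ x in Ω, fderiv ℝ φ x (ν + e)) -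
      ∫ x, φ x ∂(surfaceMeasure Ω)‖ ≤ 3 * (η / 20) * ∫ x, ‖φ x‖ ∂(surfaceMeasure Ω) :=
    fun e he => h.norm_integral_fderiv_sub_le hΩ hε hK1 hK2 (η := η')
      (by rw [← NNReal.coe_le_coe]; push_cast; exact hKη) he hφ hsupp
  set t := inner ℝ ν d with ht
  have hνd : |t| ≤ 1 := by
    have := abs_real_inner_le_norm ν d
    rw [h.norm_normal, one_mul] at this
    exact this.trans hd
  have hmem : d - t • ν ∈ (ℝ ∙ ν)ᗮ := by
    rw [Submodule.mem_orthogonal_singleton_iff_inner_right, inner_sub_right, inner_smul_right,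
      real_inner_self_eq_norm_sq, h.norm_normal]
    simp [ht]
  set e : (ℝ ∙ ν)ᗮ := ⟨d - t • ν, hmem⟩ with he
  have he1 : ‖e‖ ≤ 1 := by
    change ‖d - t • ν‖ ≤ 1
    have h1 : ‖d - t • ν‖ ^ 2 = ‖d‖ ^ 2 - t ^ 2 := by
      rw [norm_sub_sq_real, inner_smul_right, norm_smul, h.norm_normal, real_inner_comm, ← ht,
        Real.norm_eq_abs, mul_one, sq_abs]
      ring
    nlinarith [sq_nonneg t, norm_nonneg (d - t • ν), norm_nonneg d]
  have h0 := hloc 0 (by simp)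
  have h1 := hloc e he1
  have hd2 : ∀ x, fderiv ℝ φ x d = (t - 1) • fderiv ℝ φ x (ν + (0 : (ℝ ∙ ν)ᗮ)) +
      fderiv ℝ φ x (ν + e) := by
    intro x
    rw [← map_smul, ← map_add]
    congr 1
    simp only [he, Submodule.coe_zero]
    module
  set N := ∫ x, ‖φ x‖ ∂(surfaceMeasure Ω) with hN
  set I := ∫ x, φ x ∂(surfaceMeasure Ω) with hI
  have hφf : ContinuousOn φ (frontier Ω) := hφ.continuousOn.mono frontier_subset_closure
  have hφint := hΩ.integrable_surfaceMeasure hφf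
  have hνφ : Integrable (fun x => inner ℝ (outerNormal Ω x) d • φ x) (surfaceMeasure Ω) :=
    hΩ.integrable_surfaceMeasure
      ((hΩ.continuousOn_outerNormal.inner continuousOn_const).smul hφf)
  have e1 : ∫ x in Ω, fderiv ℝ φ x d = (t - 1) • (∫ x in Ω, fderiv ℝ φ x (ν + (0 : (ℝ ∙ ν)ᗮ))) +
      ∫ x in Ω, fderiv ℝ φ x (ν + e) := by
    simp_rw [hd2]
    rw [← integral_smul]
    exact integral_add ((hφ.integrableOn_fderiv hΩ _).smul (t - 1)) (hφ.integrableOn_fderiv hΩ _)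
  have e2 : ‖t • I - ∫ x, inner ℝ (outerNormal Ω x) d • φ x ∂(surfaceMeasure Ω)‖ ≤ ε * N := by
    rw [hI, ← integral_smul,
      ← integral_sub (f := fun x => t • φ x) (hφint.smul t) hνφ, hN, ← integral_const_mul]
    refine norm_integral_le_of_norm_le (hφint.norm.const_mul ε) ?_
    refine (ae_restrict_iff' isClosed_frontier.measurableSet).2 (ae_of_all _ fun x hx => ?_)
    rw [← sub_smul, norm_smul, Real.norm_eq_abs]
    by_cases hxb : x ∈ Metric.ball p r
    · gcongr
      rw [ht, ← inner_sub_left]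
      refine (abs_real_inner_le_norm _ _).trans ?_
      have := hn x hxb hx
      rw [norm_sub_rev] at this
      calc _ ≤ ε * 1 := mul_le_mul this hd (norm_nonneg _) hε0.le
        _ = ε := mul_one _
    · rw [image_eq_zero_of_notMem_tsupport fun h' => hxb (hsupp h')]
      simp
  have hN0 : 0 ≤ N := integral_nonneg fun _ => norm_nonneg _
  set A := ∫ x in Ω, fderiv ℝ φ x (ν + (0 : (ℝ ∙ ν)ᗮ)) with hA
  set B := ∫ x in Ω, fderiv ℝ φ x (ν + e) with hB
  set J := ∫ x, inner ℝ (outerNormal Ω x) d • φ x ∂(surfaceMeasure Ω) with hJ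
  have e3 : (∫ x in Ω, fderiv ℝ φ x d) - J = (t - 1) • (A - I) + (B - I) + (t • I - J) := by
    rw [e1]; module
  rw [e3]
  have e4 : |t - 1| ≤ 2 := by
    have := abs_le.1 hνd
    exact abs_le.2 ⟨by linarith, by linarith⟩
  calc _ ≤ ‖(t - 1) • (A - I)‖ + ‖B - I‖ + ‖t • I - J‖ := norm_add₃_le
    _ ≤ 2 * (3 * (η / 20) * N) + 3 * (η / 20) * N + ε * N := by
        gcongr
        rw [norm_smul, Real.norm_eq_abs]
        exact mul_le_mul e4 h0 (norm_nonneg _) (by norm_num)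
    _ ≤ η * N := by nlinarith

theorem IsC1UpToBoundary.smul (hΩ : IsBoundedSmoothDomain Ω) {χ : EuclideanSpace ℝ (Fin n) → ℝ}
    (hχ : ContDiff ℝ ∞ χ) (hφ : IsC1UpToBoundary Ω φ) :
    IsC1UpToBoundary Ω (fun x => χ x • φ x) := by
  have hK := hΩ.isBounded.isCompact_closure
  refine ⟨hχ.continuous.continuousOn.smul hφ.continuousOn,
    (hχ.of_le (by simp)).contDiffOn.smul hφ.contDiffOn, ?_⟩
  obtain ⟨C, hC⟩ := hφ.bounded
  obtain ⟨C1, hC1⟩ := hK.exists_bound_of_continuousOn hφ.continuousOn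
  obtain ⟨C2, hC2⟩ := hK.exists_bound_of_continuousOn hχ.continuous.continuousOn
  obtain ⟨C3, hC3⟩ := hK.exists_bound_of_continuousOn
    (hχ.continuous_fderiv (by simp)).continuousOn
  refine ⟨C2 * C + C3 * C1, fun x hx => ?_⟩
  have hx' := subset_closure hx
  rw [fderiv_fun_smul (hχ.differentiable (by simp) x)
    ((hφ.contDiffOn.contDiffAt (hΩ.isOpen.mem_nhds hx)).differentiableAt (by simp))]
  refine (norm_add_le _ _).trans (add_le_add ?_ ?_)
  · rw [norm_smul]
    exact mul_le_mul (hC2 x hx') (hC x hx) (norm_nonneg _) ((norm_nonneg _).trans (hC2 x hx'))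
  · rw [ContinuousLinearMap.norm_smulRight_apply]
    exact mul_le_mul (hC3 x hx') (hC1 x hx') (norm_nonneg _) ((norm_nonneg _).trans (hC3 x hx'))

theorem integral_fderiv_eq_zero_of_tsupport_subset (hΩ : IsBoundedSmoothDomain Ω)
    (hφ : IsC1UpToBoundary Ω φ) (hsupp : tsupport φ ⊆ Ω) (d : EuclideanSpace ℝ (Fin n)) :
    ∫ x in Ω, fderiv ℝ φ x d = 0 := by
  have hdiff : Differentiable ℝ φ := fun x => by
    by_cases h : x ∈ tsupport φ
    · exact (hφ.contDiffOn.contDiffAt (hΩ.isOpen.mem_nhds (hsupp h))).differentiableAt (by simp)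
    · have h1 : φ =ᶠ[nhds x] fun _ => 0 := notMem_tsupport_iff_eventuallyEq.1 h
      exact (h1.differentiableAt_iff).2 (differentiableAt_const _)
  have h0 : ∀ x ∉ Ω, fderiv ℝ φ x d = 0 := fun x hx => by
    rw [fderiv_eq_zero_of_notMem_tsupport fun h => hx (hsupp h), zero_apply]
  rw [setIntegral_eq_integral_of_forall_compl_eq_zero h0]
  have hcs : HasCompactSupport φ := hΩ.isBounded.isCompact_closure.of_isClosed_subset
    (isClosed_tsupport φ) (hsupp.trans subset_closure)
  have hint : Integrable fun x => fderiv ℝ φ x d :=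
    (integrableOn_iff_integrable_of_support_subset
      (Function.support_subset_iff'.2 h0)).1 (hφ.integrableOn_fderiv hΩ d)
  -- Integration by parts on the whole space with the constant function `1` as the other factor.
  have := integral_smul_fderiv_eq_neg_fderiv_smul_of_integrable (μ := volume)
    (f := fun _ : EuclideanSpace ℝ (Fin n) => (1 : ℝ)) (g := φ) (v := d)
    (by simp) (by simpa using hint)
    (by simpa using hdiff.continuous.integrable_of_hasCompactSupport hcs)
    (fun x _ => differentiableAt_const _) (fun x _ => hdiff x)
  simpa using this

/-- The local error is a multiple of `∫ |φ| dS`. As the cut-offs are nonnegative with sum `1`, the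
integrals `∫ |χᵢ φ| dS` add up to `∫ |φ| dS`, so the number of patches does not enter the bound. -/
theorem IsBoundedSmoothDomain.norm_gauss_error_le [CompleteSpace F] (hΩ : IsBoundedSmoothDomain Ω)
    (hφ : IsC1UpToBoundary Ω φ) {d : EuclideanSpace ℝ (Fin n)} (hd : ‖d‖ ≤ 1)
    {η : ℝ} (hη : 0 < η) :
    ‖(∫ x in Ω, fderiv ℝ φ x d) -
        ∫ x, inner ℝ (outerNormal Ω x) d • φ x ∂(surfaceMeasure Ω)‖ ≤
      η * ∫ x, ‖φ x‖ ∂(surfaceMeasure Ω) := by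
  have hK := hΩ.isBounded.isCompact_closure
  have hloc : ∀ p ∈ closure Ω, ∃ r > 0, ∀ φ : EuclideanSpace ℝ (Fin n) → F,
      IsC1UpToBoundary Ω φ → tsupport φ ⊆ Metric.ball p r →
      ‖(∫ x in Ω, fderiv ℝ φ x d) -
        ∫ x, inner ℝ (outerNormal Ω x) d • φ x ∂(surfaceMeasure Ω)‖ ≤
      η * ∫ x, ‖φ x‖ ∂(surfaceMeasure Ω) := by
    intro p hp
    by_cases hpΩ : p ∈ Ω
    · obtain ⟨r, hr, hball⟩ := Metric.isOpen_iff.1 hΩ.isOpen p hpΩ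
      refine ⟨r, hr, fun φ hφ hsupp => ?_⟩
      have hz : ∀ᵐ x ∂(surfaceMeasure Ω), inner ℝ (outerNormal Ω x) d • φ x = (0 : F) := by
        refine (ae_restrict_iff' isClosed_frontier.measurableSet).2 (ae_of_all _ fun x hx => ?_)
        have hx0 : φ x = 0 := by
          refine image_eq_zero_of_notMem_tsupport fun h => ?_
          rw [hΩ.isOpen.frontier_eq] at hx
          exact hx.2 (hball (hsupp h))
        rw [hx0, smul_zero]
      rw [integral_fderiv_eq_zero_of_tsupport_subset hΩ hφ (hsupp.trans hball),
        integral_congr_ae hz]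
      simp only [integral_zero, sub_zero, norm_zero]
      exact mul_nonneg hη.le (integral_nonneg fun _ => norm_nonneg _)
    · obtain ⟨r, hr, h⟩ := hΩ.exists_local_gauss (F := F)
        (by rw [hΩ.isOpen.frontier_eq]; exact ⟨hp, hpΩ⟩ : p ∈ frontier Ω) hη
      exact ⟨r, hr, fun φ hφ hsupp => h φ hφ hsupp d hd⟩
  choose! R hR0 hR using hloc
  obtain ⟨t, htK, htcov⟩ := hK.elim_nhds_subcover (fun p => Metric.ball p (R p))
    fun p hp => Metric.ball_mem_nhds p (hR0 p hp)
  obtain ⟨χ, hχ⟩ := SmoothPartitionOfUnity.exists_isSubordinate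
    (modelWithCornersSelf ℝ (EuclideanSpace ℝ (Fin n))) (isClosed_closure (s := Ω))
    (fun i : t => Metric.ball (i : EuclideanSpace ℝ (Fin n)) (R i)) (fun i => Metric.isOpen_ball)
    (by simpa [iUnion_subtype] using htcov)
  have hχs : ∀ i, ContDiff ℝ ∞ (χ i) := fun i => (χ i).contMDiff.contDiff
  have hsum : ∀ x ∈ closure Ω, ∑ i, χ i x = 1 := fun x hx => by
    rw [← χ.sum_eq_one hx, finsum_eq_sum_of_fintype]
  have hc : ∀ i, IsC1UpToBoundary Ω (fun x => χ i x • φ x) := fun i => hφ.smul hΩ (hχs i)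
  have hsupp : ∀ i, tsupport (fun x => χ i x • φ x) ⊆ Metric.ball (i : EuclideanSpace ℝ (Fin n))
      (R i) := fun i => (tsupport_smul_subset_left (χ i) φ).trans (hχ i)
  have e1 : ∫ x in Ω, fderiv ℝ φ x d = ∑ i, ∫ x in Ω, fderiv ℝ (fun x => χ i x • φ x) x d := by
    rw [← integral_finsetSum _ fun i _ => (hc i).integrableOn_fderiv hΩ d]
    refine setIntegral_congr_fun hΩ.isOpen.measurableSet fun x hx => ?_
    have h1 : φ =ᶠ[nhds x] fun y => ∑ i, χ i y • φ y := by
      filter_upwards [hΩ.isOpen.mem_nhds hx] with y hy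
      rw [← Finset.sum_smul, hsum y (subset_closure hy), one_smul]
    change fderiv ℝ φ x d = ∑ i, fderiv ℝ (fun x => χ i x • φ x) x d
    rw [h1.fderiv_eq, fderiv_fun_sum fun i _ =>
      ((hc i).contDiffOn.contDiffAt (hΩ.isOpen.mem_nhds hx)).differentiableAt (by simp)]
    simp
  have hfrint : ∀ i, Integrable (fun x => inner ℝ (outerNormal Ω x) d • χ i x • φ x)
      (surfaceMeasure Ω) := fun i => hΩ.integrable_surfaceMeasure
    ((hΩ.continuousOn_outerNormal.inner continuousOn_const).smul
      ((hc i).continuousOn.mono frontier_subset_closure))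
  have e2 : ∫ x, inner ℝ (outerNormal Ω x) d • φ x ∂(surfaceMeasure Ω) =
      ∑ i, ∫ x, inner ℝ (outerNormal Ω x) d • χ i x • φ x ∂(surfaceMeasure Ω) := by
    rw [← integral_finsetSum _ fun i _ => hfrint i]
    refine setIntegral_congr_fun isClosed_frontier.measurableSet fun x hx => ?_
    rw [← Finset.smul_sum, ← Finset.sum_smul, hsum x (frontier_subset_closure hx), one_smul]
  have e3 : ∫ x, ‖φ x‖ ∂(surfaceMeasure Ω) = ∑ i, ∫ x, ‖χ i x • φ x‖ ∂(surfaceMeasure Ω) := by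
    rw [← integral_finsetSum _ fun i _ => (hΩ.integrable_surfaceMeasure
      ((hc i).continuousOn.mono frontier_subset_closure)).norm]
    refine setIntegral_congr_fun isClosed_frontier.measurableSet fun x hx => ?_
    change _ = ∑ i, ‖χ i x • φ x‖
    simp_rw [norm_smul, Real.norm_of_nonneg (χ.nonneg _ x)]
    rw [← Finset.sum_mul, hsum x (frontier_subset_closure hx), one_mul]
  rw [e1, e2, e3, ← Finset.sum_sub_distrib, Finset.mul_sum]
  exact norm_sum_le_of_le _ fun i _ => hR i (htK i i.2) _ (hc i) (hsupp i)

/-- **Gauss' theorem** on a bounded domain with smooth boundary, for a directional derivative. -/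
theorem IsBoundedSmoothDomain.integral_fderiv_eq [CompleteSpace F] (hΩ : IsBoundedSmoothDomain Ω)
    (hφ : IsC1UpToBoundary Ω φ) {d : EuclideanSpace ℝ (Fin n)} (hd : ‖d‖ ≤ 1) :
    ∫ x in Ω, fderiv ℝ φ x d =
      ∫ x, inner ℝ (outerNormal Ω x) d • φ x ∂(surfaceMeasure Ω) := by
  rw [← sub_eq_zero, ← norm_le_zero_iff]
  set N := ∫ x, ‖φ x‖ ∂(surfaceMeasure Ω)
  have hN : 0 ≤ N := integral_nonneg fun _ => norm_nonneg _
  refine le_of_forall_pos_le_add fun ε hε => ?_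
  -- Dividing by `N + 1` instead of `N` covers the case `N = 0`.
  refine (hΩ.norm_gauss_error_le hφ hd (η := ε / (N + 1)) (by positivity)).trans ?_
  rw [zero_add, div_mul_eq_mul_div, div_le_iff₀ (by positivity)]
  nlinarith

end Gauss

/-! ### Green's second identity. -/

section Green

variable {n : ℕ} {Ω : Set (EuclideanSpace ℝ (Fin n))} {𝕜 : Type*} [RCLike 𝕜]
  {φ ψ : EuclideanSpace ℝ (Fin n) → 𝕜}

theorem fderivWithin_closure_eventuallyEq (hΩ : IsOpen Ω) {x : EuclideanSpace ℝ (Fin n)}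
    (hx : x ∈ Ω) (φ : EuclideanSpace ℝ (Fin n) → 𝕜) :
    fderivWithin ℝ φ (closure Ω) =ᶠ[nhds x] fderiv ℝ φ := by
  filter_upwards [hΩ.mem_nhds hx] with y hy
  exact fderivWithin_of_mem_nhds (Filter.mem_of_superset (hΩ.mem_nhds hy) subset_closure)

theorem IsBoundedSmoothDomain.isC1UpToBoundary (hΩ : IsBoundedSmoothDomain Ω)
    (hφ : ContDiffOn ℝ 1 φ (closure Ω)) : IsC1UpToBoundary Ω φ := by
  refine ⟨hφ.continuousOn, hφ.mono subset_closure, ?_⟩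
  obtain ⟨C, hC⟩ := hΩ.isBounded.isCompact_closure.exists_bound_of_continuousOn
    (hφ.continuousOn_fderivWithin hΩ.uniqueDiffOn_closure (by simp))
  refine ⟨C, fun x hx => ?_⟩
  rw [← (fderivWithin_closure_eventuallyEq hΩ.isOpen hx _).eq_of_nhds]
  exact hC x (subset_closure hx)

/-- First derivatives taken within the closure are `C¹` up to the boundary, which puts the Laplacian
into a form to which Gauss' theorem applies. -/
theorem laplacian_eq_sum_fderivWithin_closure (hΩ : IsOpen Ω) {x : EuclideanSpace ℝ (Fin n)}
    (hx : x ∈ Ω) (hφ : ContDiffOn ℝ 2 φ (closure Ω)) :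
    (Δ φ) x = ∑ i, fderiv ℝ (fun y => fderivWithin ℝ φ (closure Ω) y
      (EuclideanSpace.basisFun (Fin n) ℝ i)) x (EuclideanSpace.basisFun (Fin n) ℝ i) := by
  rw [InnerProductSpace.laplacian_eq_iteratedFDeriv_orthonormalBasis φ
    (EuclideanSpace.basisFun (Fin n) ℝ)]
  refine Finset.sum_congr rfl fun i _ => ?_
  have hd : DifferentiableAt ℝ (fderiv ℝ φ) x := by
    have h1 : ContDiffAt ℝ 2 φ x := (hφ.mono subset_closure).contDiffAt (hΩ.mem_nhds hx)
    exact (h1.fderiv_right (m := 1) (by norm_num)).differentiableAt (by simp)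
  have h2 : (fun y => fderivWithin ℝ φ (closure Ω) y (EuclideanSpace.basisFun (Fin n) ℝ i))
      =ᶠ[nhds x] fun y => fderiv ℝ φ y (EuclideanSpace.basisFun (Fin n) ℝ i) := by
    filter_upwards [fderivWithin_closure_eventuallyEq hΩ hx φ] with y hy
    rw [hy]
  rw [iteratedFDeriv_two_apply, h2.fderiv_eq, fderiv_clm_apply hd (differentiableAt_const _)]
  simp

theorem IsBoundedSmoothDomain.contDiffOn_fderivWithin (hΩ : IsBoundedSmoothDomain Ω)
    (hφ : ContDiffOn ℝ 2 φ (closure Ω)) (d : EuclideanSpace ℝ (Fin n)) :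
    ContDiffOn ℝ 1 (fun x => fderivWithin ℝ φ (closure Ω) x d) (closure Ω) :=
  (hφ.fderivWithin hΩ.uniqueDiffOn_closure (by norm_num)).clm_apply contDiffOn_const

/-- **Green's second identity** on a bounded domain with smooth boundary. -/
theorem IsBoundedSmoothDomain.integral_laplacian_mul_sub (hΩ : IsBoundedSmoothDomain Ω)
    (hφ : ContDiffOn ℝ 2 φ (closure Ω)) (hψ : ContDiffOn ℝ 2 ψ (closure Ω)) :
    ∫ x in Ω, ((Δ φ) x * ψ x - φ x * (Δ ψ) x) =
      ∫ x, (fderivWithin ℝ φ (closure Ω) x (outerNormal Ω x) * ψ x -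
        φ x * fderivWithin ℝ ψ (closure Ω) x (outerNormal Ω x)) ∂(surfaceMeasure Ω) := by
  set b := EuclideanSpace.basisFun (Fin n) ℝ with hb
  -- The components of the field `ψ ∇φ - φ ∇ψ`, in whose divergence the products of first
  -- derivatives cancel.
  let g : Fin n → EuclideanSpace ℝ (Fin n) → 𝕜 := fun i x =>
    fderivWithin ℝ φ (closure Ω) x (b i) * ψ x - φ x * fderivWithin ℝ ψ (closure Ω) x (b i)
  have hφ1 := fun i => hΩ.contDiffOn_fderivWithin hφ (b i)
  have hψ1 := fun i => hΩ.contDiffOn_fderivWithin hψ (b i)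
  have hg : ∀ i, ContDiffOn ℝ 1 (g i) (closure Ω) := fun i =>
    ((hφ1 i).mul (hψ.of_le (by norm_num))).sub ((hφ.of_le (by norm_num)).mul (hψ1 i))
  have hg' := fun i => hΩ.isC1UpToBoundary (hg i)
  have hgauss : ∀ i, ∫ x in Ω, fderiv ℝ (g i) x (b i) =
      ∫ x, inner ℝ (outerNormal Ω x) (b i) • g i x ∂(surfaceMeasure Ω) := fun i =>
    hΩ.integral_fderiv_eq (hg' i) (by simp)
  have e1 : ∫ x in Ω, ((Δ φ) x * ψ x - φ x * (Δ ψ) x) =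
      ∫ x in Ω, ∑ i, fderiv ℝ (g i) x (b i) := by
    refine setIntegral_congr_fun hΩ.isOpen.measurableSet fun x hx => ?_
    have hn := hΩ.isOpen.mem_nhds hx
    have hdφ : DifferentiableAt ℝ φ x :=
      ((hφ.mono subset_closure).contDiffAt hn).differentiableAt (by simp)
    have hdψ : DifferentiableAt ℝ ψ x :=
      ((hψ.mono subset_closure).contDiffAt hn).differentiableAt (by simp)
    have hdφ1 := fun i => (((hφ1 i).mono subset_closure).contDiffAt hn).differentiableAt (by simp)
    have hdψ1 := fun i => (((hψ1 i).mono subset_closure).contDiffAt hn).differentiableAt (by simp)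
    change (Δ φ) x * ψ x - φ x * (Δ ψ) x = ∑ i, fderiv ℝ (g i) x (b i)
    rw [laplacian_eq_sum_fderivWithin_closure hΩ.isOpen hx hφ,
      laplacian_eq_sum_fderivWithin_closure hΩ.isOpen hx hψ, Finset.sum_mul, Finset.mul_sum,
      ← Finset.sum_sub_distrib]
    refine Finset.sum_congr rfl fun i _ => ?_
    have hA := ((hdφ1 i).hasFDerivAt.mul' hdψ.hasFDerivAt).sub
      (hdφ.hasFDerivAt.mul' (hdψ1 i).hasFDerivAt)
    have hA' : fderiv ℝ (g i) x = _ := hA.fderiv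
    rw [hA']
    simp only [sub_apply, add_apply, smul_apply, smul_eq_mul,
      (fderivWithin_closure_eventuallyEq hΩ.isOpen hx _).eq_of_nhds, ← hb,
      MulOpposite.smul_eq_mul_unop, MulOpposite.unop_op]
    ring
  have e2 : ∫ x, (fderivWithin ℝ φ (closure Ω) x (outerNormal Ω x) * ψ x -
        φ x * fderivWithin ℝ ψ (closure Ω) x (outerNormal Ω x)) ∂(surfaceMeasure Ω) =
      ∫ x, ∑ i, inner ℝ (outerNormal Ω x) (b i) • g i x ∂(surfaceMeasure Ω) := by
    refine integral_congr_ae (ae_of_all _ fun x => ?_)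
    have hsum : ∀ L : EuclideanSpace ℝ (Fin n) →L[ℝ] 𝕜, L (outerNormal Ω x) =
        ∑ i, inner ℝ (outerNormal Ω x) (b i) • L (b i) := fun L => by
      conv_lhs => rw [← b.sum_repr' (outerNormal Ω x)]
      rw [map_sum]
      refine Finset.sum_congr rfl fun i _ => ?_
      rw [map_smul, real_inner_comm]
    simp only [hsum, g, Finset.sum_mul, Finset.mul_sum, smul_sub, ← Finset.sum_sub_distrib,
      smul_mul_assoc, mul_smul_comm]
  rw [e1, e2, integral_finsetSum _ fun i _ => (hg' i).integrableOn_fderiv hΩ (b i),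
    integral_finsetSum (f := fun i x => inner ℝ (outerNormal Ω x) (b i) • g i x) _
      fun i _ => hΩ.integrable_surfaceMeasure ((hΩ.continuousOn_outerNormal.inner continuousOn_const).smul
        ((hg i).continuousOn.mono frontier_subset_closure))]
  exact Finset.sum_congr rfl fun i _ => hgauss i

end Green

/-! ### The low-pass filter at a fixed point of space. -/

section LowPass

variable {𝕜 : Type*} [RCLike 𝕜]

theorem intervalIntegral_primitive_hasDerivAt {v : ℝ → 𝕜} {α β s t : ℝ}
    (hv : ContinuousOn v (Icc α β)) (hs : s ∈ Icc α β) (ht : t ∈ Ioo α β) :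
    HasDerivAt (fun t => ∫ τ in s..t, v τ) (v t) t := by
  have hn : Icc α β ∈ nhds t := Icc_mem_nhds ht.1 ht.2
  refine intervalIntegral.integral_hasDerivAt_right ?_ ?_ (hv.continuousAt hn)
  · exact (hv.mono (uIcc_subset_Icc hs (Ioo_subset_Icc_self ht))).intervalIntegrable
  · exact ⟨Icc α β, hn, hv.aestronglyMeasurable measurableSet_Icc⟩

theorem continuousOn_intervalIntegral_primitive {v : ℝ → 𝕜} {α β s : ℝ}
    (hv : ContinuousOn v (Icc α β)) (hs : s ∈ Icc α β) :
    ContinuousOn (fun t => ∫ τ in s..t, v τ) (Icc α β) := by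
  have hle : α ≤ β := hs.1.trans hs.2
  have h := intervalIntegral.continuousOn_primitive_interval' (μ := volume) (f := v) (b₁ := α)
    (b₂ := β) (a := s) (by
      refine ContinuousOn.intervalIntegrable ?_
      rwa [uIcc_of_le hle]) (by rwa [uIcc_of_le hle])
  rwa [uIcc_of_le hle] at h

/-- Integration by parts against the low-pass filter `J`, at a fixed point of space. -/
theorem mul_eq_integral_lowPass {δ T : ℝ} (hδ : δ < T) {z z1 z2 v v1 v2 : ℝ → 𝕜}
    (hz : ContinuousOn z (Icc δ (2 * T - δ))) (hz1 : ContinuousOn z1 (Icc δ (2 * T - δ)))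
    (hz2 : ContinuousOn z2 (Icc δ (2 * T - δ))) (hv : ContinuousOn v (Icc δ (2 * T - δ)))
    (hv1 : ContinuousOn v1 (Icc δ (2 * T - δ))) (hv2 : ContinuousOn v2 (Icc δ (2 * T - δ)))
    (hdz : ∀ t ∈ Ioo δ (2 * T - δ), HasDerivAt z (z1 t) t)
    (hdz1 : ∀ t ∈ Ioo δ (2 * T - δ), HasDerivAt z1 (z2 t) t)
    (hdv : ∀ t ∈ Ioo δ (2 * T - δ), HasDerivAt v (v1 t) t)
    (hdv1 : ∀ t ∈ Ioo δ (2 * T - δ), HasDerivAt v1 (v2 t) t)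
    (hz0 : z δ = 0) (hz10 : z1 δ = 0) :
    z T * v T = ∫ t in δ..T, (z2 t * ((1 / 2 : ℝ) • ∫ τ in t..(2 * T - t), v τ) -
      z t * ((1 / 2 : ℝ) • ∫ τ in t..(2 * T - t), v2 τ)) := by
  have hTI : T ∈ Icc δ (2 * T - δ) := ⟨hδ.le, by linarith⟩
  have hsub : Icc δ T ⊆ Icc δ (2 * T - δ) := Icc_subset_Icc_right hTI.2
  have hrefl : ∀ t ∈ Icc δ T, 2 * T - t ∈ Icc δ (2 * T - δ) := fun t ht =>
    ⟨by linarith [ht.2], by linarith [ht.1]⟩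
  have hvint : ∀ t ∈ Icc δ (2 * T - δ), ∀ s ∈ Icc δ (2 * T - δ),
      IntervalIntegrable v volume s t := fun t ht s hs =>
    (hv.mono (uIcc_subset_Icc hs ht)).intervalIntegrable
  set G : ℝ → 𝕜 := fun t => ∫ τ in T..t, v τ with hG
  have hGc : ContinuousOn G (Icc δ (2 * T - δ)) := continuousOn_intervalIntegral_primitive hv hTI
  have hGd : ∀ t ∈ Ioo δ (2 * T - δ), HasDerivAt G (v t) t := fun t ht =>
    intervalIntegral_primitive_hasDerivAt hv hTI ht
  have hJ : ∀ t ∈ Icc δ T, ∫ τ in t..(2 * T - t), v τ = G (2 * T - t) - G t := by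
    intro t ht
    rw [hG, ← intervalIntegral.integral_interval_sub_left (hvint _ (hrefl t ht) _ hTI)
      (hvint _ (hsub ht) _ hTI)]
  have hJ2 : ∀ t ∈ Icc δ T, ∫ τ in t..(2 * T - t), v2 τ = v1 (2 * T - t) - v1 t := by
    intro t ht
    have hle : t ≤ 2 * T - t := by linarith [ht.2]
    have hss : Icc t (2 * T - t) ⊆ Icc δ (2 * T - δ) :=
      Icc_subset_Icc ht.1 (by linarith [ht.1])
    refine intervalIntegral.integral_eq_sub_of_hasDerivAt_of_le hle (hv1.mono hss)
      (fun s hs => hdv1 s ⟨ht.1.trans_lt hs.1, by linarith [hs.2, ht.1]⟩) ?_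
    exact (hv2.mono ((uIcc_of_le hle).trans_subset hss)).intervalIntegrable
  -- `A = ∂ₜz · Jv - z · ∂ₜ(Jv)`, with derivative `A' = ∂ₜ²z · Jv - z · J(∂ₜ²v)`. At `T` the first
  -- term vanishes and the second is `z(T) v(T)`; at `δ` both vanish because `z` starts from rest.
  set A : ℝ → 𝕜 := fun t => z1 t * ((1 / 2 : ℝ) • (G (2 * T - t) - G t)) +
    z t * ((1 / 2 : ℝ) • (v t + v (2 * T - t))) with hA
  set A' : ℝ → 𝕜 := fun t => z2 t * ((1 / 2 : ℝ) • (G (2 * T - t) - G t)) -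
    z t * ((1 / 2 : ℝ) • (v1 (2 * T - t) - v1 t)) with hA'
  have hr : ContinuousOn (fun t : ℝ => 2 * T - t) (Icc δ T) := by fun_prop
  have hcomp : ∀ {g : ℝ → 𝕜}, ContinuousOn g (Icc δ (2 * T - δ)) →
      ContinuousOn (fun t => g (2 * T - t)) (Icc δ T) := fun hg => hg.comp hr hrefl
  have hAc : ContinuousOn A (Icc δ T) :=
    ((hz1.mono hsub).mul (((hcomp hGc).sub (hGc.mono hsub)).const_smul _)).add
      ((hz.mono hsub).mul (((hv.mono hsub).add (hcomp hv)).const_smul _))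
  have hA'c : ContinuousOn A' (Icc δ T) :=
    ((hz2.mono hsub).mul (((hcomp hGc).sub (hGc.mono hsub)).const_smul _)).sub
      ((hz.mono hsub).mul (((hcomp hv1).sub (hv1.mono hsub)).const_smul _))
  have hAd : ∀ t ∈ Ioo δ T, HasDerivAt A (A' t) t := by
    intro t ht
    have ht1 : t ∈ Ioo δ (2 * T - δ) := ⟨ht.1, by linarith [ht.1, ht.2]⟩
    have ht2 : 2 * T - t ∈ Ioo δ (2 * T - δ) := ⟨by linarith [ht.2], by linarith [ht.1]⟩
    have hcr : ∀ {g : ℝ → 𝕜} {g' : 𝕜}, HasDerivAt g g' (2 * T - t) →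
        HasDerivAt (fun s => g (2 * T - s)) (-g') t := fun hg => by
      have := HasDerivAt.comp_const_sub (2 * T) t hg
      simpa using this
    have h1 := ((hdz1 t ht1).mul (((hcr (hGd _ ht2)).sub (hGd t ht1)).const_smul (1 / 2 : ℝ))).add
      ((hdz t ht1).mul (((hdv t ht1).add (hcr (hdv _ ht2))).const_smul (1 / 2 : ℝ)))
    refine h1.congr_deriv ?_
    simp only [hA', RCLike.real_smul_eq_coe_mul, Pi.smul_apply, Pi.sub_apply, Pi.add_apply]
    ring
  have hftc := intervalIntegral.integral_eq_sub_of_hasDerivAt_of_le hδ.le hAc hAd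
    (by
      refine ContinuousOn.intervalIntegrable ?_
      rwa [uIcc_of_le hδ.le])
  have hAT : A T = z T * v T := by
    have e : 2 * T - T = T := by ring
    simp only [hA, e, sub_self, mul_zero, zero_add, RCLike.real_smul_eq_coe_mul]
    push_cast
    ring
  have hAδ : A δ = 0 := by simp [hA, hz0, hz10]
  rw [hAT, hAδ, sub_zero] at hftc
  rw [← hftc]
  refine intervalIntegral.integral_congr fun t ht => ?_
  rw [uIcc_of_le hδ.le] at ht
  simp only [hA', hJ t ht, hJ2 t ht]

/-- The points `(t, τ)` with `δ < t < T` and `t < τ < 2T - t`. -/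
def timeTriangle (δ T : ℝ) : Set (ℝ × ℝ) :=
  {q | q.1 ∈ Ioo δ T ∧ q.2 ∈ Ioo q.1 (2 * T - q.1)}

theorem isOpen_timeTriangle (δ T : ℝ) : IsOpen (timeTriangle δ T) := by
  unfold timeTriangle
  simp only [mem_Ioo, ofPred_and]
  exact ((isOpen_lt (by fun_prop) (by fun_prop)).inter (isOpen_lt (by fun_prop) (by fun_prop))).inter
    ((isOpen_lt (by fun_prop) (by fun_prop)).inter (isOpen_lt (by fun_prop) (by fun_prop)))

theorem timeTriangle_subset (δ T : ℝ) :
    timeTriangle δ T ⊆ Ioo δ (2 * T - δ) ×ˢ Ioo δ (2 * T - δ) := by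
  rintro ⟨t, τ⟩ ⟨⟨h1, h2⟩, h3, h4⟩
  exact ⟨⟨h1, by linarith⟩, ⟨by linarith, by linarith⟩⟩

theorem volume_timeTriangle_lt_top (δ T : ℝ) : volume (timeTriangle δ T) < ⊤ :=
  (measure_mono (timeTriangle_subset δ T)).trans_lt (by
    rw [Measure.volume_eq_prod, Measure.prod_prod]
    exact ENNReal.mul_lt_top measure_Ioo_lt_top measure_Ioo_lt_top)

end LowPass

/-! ### Fubini's theorem for the filter, over the domain and over its boundary. -/

section Fubini

variable {𝕜 : Type*} [RCLike 𝕜] {n : ℕ} {S : Set (EuclideanSpace ℝ (Fin n))}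
  {m : Measure (EuclideanSpace ℝ (Fin n))} {δ T : ℝ}
  {a b : ℝ → EuclideanSpace ℝ (Fin n) → 𝕜} {I : Set ℝ}

/-- `a` is continuous and bounded on `I × S`. -/
structure IsBoundedContinuousOn (I : Set ℝ) (S : Set (EuclideanSpace ℝ (Fin n)))
    (a : ℝ → EuclideanSpace ℝ (Fin n) → 𝕜) : Prop where
  continuousOn : ContinuousOn (fun q : ℝ × EuclideanSpace ℝ (Fin n) => a q.1 q.2) (I ×ˢ S)
  bounded : ∃ C, ∀ t ∈ I, ∀ x ∈ S, ‖a t x‖ ≤ C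

theorem lowPass_eq_setIntegral (b : ℝ → EuclideanSpace ℝ (Fin n) → 𝕜) {t : ℝ} (ht : t ≤ T)
    (x : EuclideanSpace ℝ (Fin n)) :
    lowPass T b t x = (1 / 2 : ℝ) • ∫ τ in Ioo t (2 * T - t), b τ x := by
  rw [lowPass, intervalIntegral.integral_of_le (by linarith), integral_Ioc_eq_integral_Ioo]

/-- The filter is a partial integral of `b` cut off to the open region `t < τ < 2T - t`. The
condition `m.restrict S = m` says that `m` lives on `S`; this treats Lebesgue measure on `Ω` and
surface measure on `∂Ω` at once. -/
theorem aestronglyMeasurable_lowPass [SFinite m] (hS : MeasurableSet S) (hm : m.restrict S = m)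
    (hb : IsBoundedContinuousOn (Ioo δ (2 * T - δ)) S b) :
    AEStronglyMeasurable (fun q : ℝ × EuclideanSpace ℝ (Fin n) => lowPass T b q.1 q.2)
      ((volume.restrict (Ioo δ T)).prod m) := by
  let D : Set ((ℝ × EuclideanSpace ℝ (Fin n)) × ℝ) := {w | w.2 ∈ Ioo w.1.1 (2 * T - w.1.1)}
  have hD : MeasurableSet D := by
    have : IsOpen D := by
      simp only [D, mem_Ioo, ofPred_and]
      exact (isOpen_lt (by fun_prop) (by fun_prop)).inter (isOpen_lt (by fun_prop) (by fun_prop))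
    exact this.measurableSet
  have h1 : AEStronglyMeasurable (D.indicator fun w => b w.2 w.1.2)
      (((volume.restrict (Ioo δ T)).prod m).prod volume) := by
    rw [aestronglyMeasurable_indicator_iff hD, ← hm, Measure.prod_restrict,
      ← Measure.restrict_univ (μ := (volume : Measure ℝ)), Measure.prod_restrict,
      Measure.restrict_univ, Measure.restrict_restrict hD]
    refine ContinuousOn.aestronglyMeasurable ?_
      (hD.inter ((measurableSet_Ioo.prod hS).prod MeasurableSet.univ))
    refine hb.continuousOn.comp (f := fun w : (ℝ × EuclideanSpace ℝ (Fin n)) × ℝ => (w.2, w.1.2))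
      (by fun_prop) ?_
    rintro ⟨⟨t, x⟩, τ⟩ ⟨⟨h1, h2⟩, ⟨⟨h3, h4⟩, h5⟩, -⟩
    simp only at h1 h2 h3 h4 h5
    exact ⟨⟨by linarith, by linarith⟩, h5⟩
  have h2 := h1.integral_prod_right'.const_smul (1 / 2 : ℝ)
  refine h2.congr ?_
  have hae : ∀ᵐ q : ℝ × EuclideanSpace ℝ (Fin n) ∂((volume.restrict (Ioo δ T)).prod m),
      q.1 ∈ Ioo δ T :=
    Measure.quasiMeasurePreserving_fst.ae (ae_restrict_mem measurableSet_Ioo)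
  filter_upwards [hae] with q hq
  rw [lowPass_eq_setIntegral b hq.2.le, ← integral_indicator measurableSet_Ioo]
  rfl

theorem IsBoundedContinuousOn.norm_lowPass_le (hb : IsBoundedContinuousOn (Ioo δ (2 * T - δ)) S b) :
    ∃ C, ∀ t ∈ Ioo δ T, ∀ x ∈ S, ‖lowPass T b t x‖ ≤ C := by
  obtain ⟨C, hC⟩ := hb.bounded
  refine ⟨|C| * |2 * T - 2 * δ|, fun t ht x hx => ?_⟩
  rw [lowPass, norm_smul]
  have h1 : ‖∫ τ in t..(2 * T - t), b τ x‖ ≤ |C| * |2 * T - t - t| := by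
    refine intervalIntegral.norm_integral_le_of_norm_le_const_ae ?_
    filter_upwards [(Measure.ae_ne volume (2 * T - t))] with τ hne hτ
    rw [uIoc_of_le (by linarith [ht.2])] at hτ
    exact (hC τ ⟨by linarith [ht.1, hτ.1], by linarith [ht.1, hτ.2]⟩ x hx).trans (le_abs_self C)
  have h2 : |2 * T - t - t| ≤ |2 * T - 2 * δ| := by
    rw [abs_of_nonneg (by linarith [ht.2]), abs_of_nonneg (by linarith [ht.1, ht.2])]
    linarith [ht.1]
  calc _ ≤ 1 * (|C| * |2 * T - t - t|) := by
        gcongr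
        norm_num
    _ ≤ _ := by rw [one_mul]; gcongr

theorem ae_prod_mem [SFinite m] (hS : MeasurableSet S) (hm : m.restrict S = m) {I : Set ℝ}
    (hI : MeasurableSet I) :
    ∀ᵐ q : ℝ × EuclideanSpace ℝ (Fin n) ∂((volume.restrict I).prod m), q.1 ∈ I ∧ q.2 ∈ S := by
  rw [← hm, Measure.prod_restrict]
  exact ae_restrict_mem (hI.prod hS)

theorem integrable_mul_lowPass [IsFiniteMeasure m] (hS : MeasurableSet S) (hm : m.restrict S = m)
    (ha : IsBoundedContinuousOn (Ioo δ T) S a)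
    (hb : IsBoundedContinuousOn (Ioo δ (2 * T - δ)) S b) :
    Integrable (fun q : ℝ × EuclideanSpace ℝ (Fin n) => a q.1 q.2 * lowPass T b q.1 q.2)
      ((volume.restrict (Ioo δ T)).prod m) := by
  have : IsFiniteMeasure (volume.restrict (Ioo δ T)) := isFiniteMeasure_restrict.2
    measure_Ioo_lt_top.ne
  obtain ⟨C, hC⟩ := ha.bounded
  obtain ⟨C', hC'⟩ := hb.norm_lowPass_le
  refine Integrable.of_bound (C := C * C') ?_ ?_
  · refine AEStronglyMeasurable.mul ?_ (aestronglyMeasurable_lowPass hS hm hb)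
    rw [← hm, Measure.prod_restrict]
    exact ha.continuousOn.aestronglyMeasurable (measurableSet_Ioo.prod hS)
  · filter_upwards [ae_prod_mem hS hm measurableSet_Ioo] with q hq
    rw [norm_mul]
    exact mul_le_mul (hC _ hq.1 _ hq.2) (hC' _ hq.1 _ hq.2) (norm_nonneg _)
      ((norm_nonneg _).trans (hC _ hq.1 _ hq.2))

theorem integrable_timeTriangle_prod [IsFiniteMeasure m] (hS : MeasurableSet S)
    (hm : m.restrict S = m) (ha : IsBoundedContinuousOn (Ioo δ T) S a)
    (hb : IsBoundedContinuousOn (Ioo δ (2 * T - δ)) S b) :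
    Integrable (fun w : (ℝ × ℝ) × EuclideanSpace ℝ (Fin n) => a w.1.1 w.2 * b w.1.2 w.2)
      ((volume.restrict (timeTriangle δ T)).prod m) := by
  have hTri := (isOpen_timeTriangle δ T).measurableSet
  have : IsFiniteMeasure (volume.restrict (timeTriangle δ T)) := isFiniteMeasure_restrict.2
    (volume_timeTriangle_lt_top δ T).ne
  obtain ⟨C, hC⟩ := ha.bounded
  obtain ⟨C', hC'⟩ := hb.bounded
  refine Integrable.of_bound (C := C * C') ?_ ?_
  · rw [← hm, Measure.prod_restrict]
    refine ContinuousOn.aestronglyMeasurable ?_ (hTri.prod hS)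
    refine ContinuousOn.mul ?_ ?_
    · refine ha.continuousOn.comp
        (f := fun w : (ℝ × ℝ) × EuclideanSpace ℝ (Fin n) => (w.1.1, w.2)) (by fun_prop) ?_
      rintro ⟨q, x⟩ ⟨hq, hx⟩
      exact ⟨hq.1, hx⟩
    · refine hb.continuousOn.comp
        (f := fun w : (ℝ × ℝ) × EuclideanSpace ℝ (Fin n) => (w.1.2, w.2)) (by fun_prop) ?_
      rintro ⟨q, x⟩ ⟨hq, hx⟩
      exact ⟨(timeTriangle_subset δ T hq).2, hx⟩
  · have hae : ∀ᵐ w ∂((volume.restrict (timeTriangle δ T)).prod m),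
        w ∈ timeTriangle δ T ×ˢ S := by
      rw [← hm, Measure.prod_restrict]
      exact ae_restrict_mem (hTri.prod hS)
    filter_upwards [hae] with w hw
    rw [norm_mul]
    exact mul_le_mul (hC _ hw.1.1 _ hw.2) (hC' _ (timeTriangle_subset δ T hw.1).2 _ hw.2)
      (norm_nonneg _) ((norm_nonneg _).trans (hC _ hw.1.1 _ hw.2))

theorem setIntegral_timeTriangle {g : ℝ × ℝ → 𝕜}
    (hg : IntegrableOn g (timeTriangle δ T)) :
    ∫ q in timeTriangle δ T, g q = ∫ t in Ioo δ T, ∫ τ in Ioo t (2 * T - t), g (t, τ) := by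
  have hTri := (isOpen_timeTriangle δ T).measurableSet
  rw [← integral_indicator hTri, Measure.volume_eq_prod, integral_prod _
    ((integrable_indicator_iff hTri).2 (by rwa [← Measure.volume_eq_prod])),
    ← integral_indicator measurableSet_Ioo]
  refine integral_congr_ae (ae_of_all _ fun t => ?_)
  by_cases ht : t ∈ Ioo δ T
  · simp only [indicator_of_mem ht]
    rw [← integral_indicator measurableSet_Ioo]
    refine integral_congr_ae (ae_of_all _ fun τ => ?_)
    by_cases hτ : τ ∈ Ioo t (2 * T - t)
    · simp only [indicator_of_mem hτ]
      rw [indicator_of_mem]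
      exact ⟨ht, hτ⟩
    · simp only [indicator_of_notMem hτ]
      rw [indicator_of_notMem]
      exact fun h => hτ h.2
  · simp only [indicator_of_notMem ht]
    refine integral_eq_zero_of_ae (ae_of_all _ fun τ => ?_)
    exact indicator_of_notMem (fun h : (t, τ) ∈ timeTriangle δ T => ht h.1) g

/-- Fubini's theorem for the low-pass filter. -/
theorem integral_mul_lowPass [IsFiniteMeasure m] (hS : MeasurableSet S)
    (hm : m.restrict S = m) (ha : IsBoundedContinuousOn (Ioo δ T) S a)
    (hb : IsBoundedContinuousOn (Ioo δ (2 * T - δ)) S b) :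
    ∫ q, a q.1 q.2 * lowPass T b q.1 q.2 ∂((volume.restrict (Ioo δ T)).prod m) =
      (1 / 2 : ℝ) • ∫ q in timeTriangle δ T, ∫ x, a q.1 x * b q.2 x ∂m := by
  have : IsFiniteMeasure (volume.restrict (timeTriangle δ T)) := isFiniteMeasure_restrict.2
    (volume_timeTriangle_lt_top δ T).ne
  have hint := integrable_timeTriangle_prod hS hm ha hb
  rw [integral_prod_symm _ (integrable_mul_lowPass hS hm ha hb),
    integral_integral_swap (f := fun (q : ℝ × ℝ) x => a q.1 x * b q.2 x) hint, ← integral_smul]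
  refine integral_congr_ae ?_
  filter_upwards [hint.swap.prod_right_ae] with x hx
  rw [setIntegral_timeTriangle (g := fun q => a q.1 x * b q.2 x) hx, ← integral_smul]
  refine setIntegral_congr_fun measurableSet_Ioo fun t ht => ?_
  change a t x * lowPass T b t x = (1 / 2 : ℝ) • ∫ τ in Ioo t (2 * T - t), a t x * b τ x
  rw [lowPass_eq_setIntegral b ht.2.le, integral_const_mul, mul_smul_comm]

end Fubini

/-! ### The identity on a closed time interval. -/

section Core

variable {𝕜 : Type*} [RCLike 𝕜] {n : ℕ} {Ω : Set (EuclideanSpace ℝ (Fin n))}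
  {z v : ℝ → EuclideanSpace ℝ (Fin n) → 𝕜} {α β δ T : ℝ}

/-- The witnesses are joint derivatives within the closed cylinder, evaluated on `(1, 0)`. They are
continuous up to the end times, where the derivatives are one-sided; the left end carries the
initial condition. -/
theorem exists_time_derivatives (hΩ : IsBoundedSmoothDomain Ω) (hαβ : α < β)
    (hz : ContDiffOn ℝ 2 (fun q : ℝ × EuclideanSpace ℝ (Fin n) => z q.1 q.2)
      (Icc α β ×ˢ closure Ω)) :
    ∃ z1 z2 : ℝ → EuclideanSpace ℝ (Fin n) → 𝕜,
      ContinuousOn (fun q : ℝ × EuclideanSpace ℝ (Fin n) => z1 q.1 q.2) (Icc α β ×ˢ closure Ω) ∧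
      ContinuousOn (fun q : ℝ × EuclideanSpace ℝ (Fin n) => z2 q.1 q.2) (Icc α β ×ˢ closure Ω) ∧
      (∀ t ∈ Icc α β, ∀ x ∈ closure Ω,
        HasDerivWithinAt (fun s => z s x) (z1 t x) (Icc α β) t) ∧
      ∀ t ∈ Icc α β, ∀ x ∈ closure Ω,
        HasDerivWithinAt (fun s => z1 s x) (z2 t x) (Icc α β) t := by
  have hu : UniqueDiffOn ℝ (Icc α β ×ˢ closure Ω) :=
    (uniqueDiffOn_Icc hαβ).prod hΩ.uniqueDiffOn_closure
  have key : ∀ {w : ℝ × EuclideanSpace ℝ (Fin n) → 𝕜}, ContDiffOn ℝ 1 w (Icc α β ×ˢ closure Ω) →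
      ∀ t ∈ Icc α β, ∀ x ∈ closure Ω, HasDerivWithinAt (fun s => w (s, x))
        (fderivWithin ℝ w (Icc α β ×ˢ closure Ω) (t, x) (1, 0)) (Icc α β) t := by
    intro w hw t ht x hx
    have h1 : HasFDerivWithinAt w _ (Icc α β ×ˢ closure Ω) (t, x) :=
      (hw.differentiableOn (by simp) (t, x) ⟨ht, hx⟩).hasFDerivWithinAt
    have h2 : HasDerivWithinAt (fun s : ℝ => (s, x)) ((1 : ℝ), (0 : EuclideanSpace ℝ (Fin n)))
        (Icc α β) t :=
      ((hasDerivAt_id t).prodMk (hasDerivAt_const t x)).hasDerivWithinAt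
    have hmt : MapsTo (fun s : ℝ => (s, x)) (Icc α β) (Icc α β ×ˢ closure Ω) :=
      fun s hs => ⟨hs, hx⟩
    exact h1.comp_hasDerivWithinAt t h2 hmt
  have h1 : ContDiffOn ℝ 1 (fun q => fderivWithin ℝ
      (fun q : ℝ × EuclideanSpace ℝ (Fin n) => z q.1 q.2) (Icc α β ×ˢ closure Ω) q (1, 0))
      (Icc α β ×ˢ closure Ω) :=
    (hz.fderivWithin hu (by norm_num)).clm_apply contDiffOn_const
  refine ⟨_, _, h1.continuousOn, (h1.continuousOn_fderivWithin hu (by simp)).clm_apply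
    continuousOn_const, fun t ht x hx => key (hz.of_le (by norm_num)) t ht x hx,
    fun t ht x hx => key h1 t ht x hx⟩

theorem contDiffOn_slice {k : WithTop ℕ∞} {I : Set ℝ} {S : Set (EuclideanSpace ℝ (Fin n))}
    (hz : ContDiffOn ℝ k (fun q : ℝ × EuclideanSpace ℝ (Fin n) => z q.1 q.2) (I ×ˢ S))
    {t : ℝ} (ht : t ∈ I) : ContDiffOn ℝ k (z t) S :=
  hz.comp (f := fun x : EuclideanSpace ℝ (Fin n) => (t, x))
    (contDiff_const.prodMk contDiff_id).contDiffOn fun _ hx => ⟨ht, hx⟩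

/-- The normal derivative is the joint derivative evaluated on `(0, ν(x))`, and `ν` is continuous on
`∂Ω`. -/
theorem continuousOn_normalDerivative (hΩ : IsBoundedSmoothDomain Ω) (hαβ : α < β)
    (hz : ContDiffOn ℝ 2 (fun q : ℝ × EuclideanSpace ℝ (Fin n) => z q.1 q.2)
      (Icc α β ×ˢ closure Ω)) :
    ContinuousOn (fun q : ℝ × EuclideanSpace ℝ (Fin n) => neumannTrace Ω z q.1 q.2)
      (Icc α β ×ˢ frontier Ω) := by
  have hu : UniqueDiffOn ℝ (Icc α β ×ˢ closure Ω) :=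
    (uniqueDiffOn_Icc hαβ).prod hΩ.uniqueDiffOn_closure
  have hsub : Icc α β ×ˢ frontier Ω ⊆ Icc α β ×ˢ closure Ω :=
    prod_mono le_rfl frontier_subset_closure
  have h1 : ContinuousOn (fun q : ℝ × EuclideanSpace ℝ (Fin n) => fderivWithin ℝ
      (fun q : ℝ × EuclideanSpace ℝ (Fin n) => z q.1 q.2) (Icc α β ×ˢ closure Ω) q
      (0, outerNormal Ω q.2)) (Icc α β ×ˢ frontier Ω) :=
    ((hz.continuousOn_fderivWithin hu (by norm_num)).mono hsub).clm_apply
      (continuousOn_const.prodMk (hΩ.continuousOn_outerNormal.comp continuousOn_snd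
        fun q hq => hq.2))
  refine h1.congr ?_
  rintro ⟨t, x⟩ ⟨ht, hx⟩
  have hxK := frontier_subset_closure hx
  simp only [neumannTrace, indicator_of_mem hx]
  have h2 : HasFDerivWithinAt (fun q : ℝ × EuclideanSpace ℝ (Fin n) => z q.1 q.2) _
      (Icc α β ×ˢ closure Ω) (t, x) :=
    (hz.differentiableOn (by simp) (t, x) ⟨ht, hxK⟩).hasFDerivWithinAt
  have h3 : HasFDerivWithinAt (fun y : EuclideanSpace ℝ (Fin n) => (t, y))
      (ContinuousLinearMap.inr ℝ ℝ (EuclideanSpace ℝ (Fin n))) (closure Ω) x :=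
    (hasFDerivAt_prodMk_right t x).hasFDerivWithinAt
  have h4 := h2.comp x h3 fun y hy => ⟨ht, hy⟩
  have h5 : fderivWithin ℝ (z t) (closure Ω) x = _ := h4.fderivWithin (hΩ.uniqueDiffOn_closure x hxK)
  rw [h5]
  simp

theorem iteratedDeriv_two_eq {g g1 : ℝ → 𝕜} {g2 : 𝕜} {t : ℝ} (ht : t ∈ Ioo α β)
    (h1 : ∀ s ∈ Icc α β, HasDerivWithinAt g (g1 s) (Icc α β) s)
    (h2 : HasDerivWithinAt g1 g2 (Icc α β) t) : iteratedDeriv 2 g t = g2 := by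
  have h3 : deriv g =ᶠ[nhds t] g1 := by
    filter_upwards [Ioo_mem_nhds ht.1 ht.2] with s hs
    exact ((h1 s (Ioo_subset_Icc_self hs)).hasDerivAt (Icc_mem_nhds hs.1 hs.2)).deriv
  rw [iteratedDeriv_succ, iteratedDeriv_one, h3.deriv_eq]
  exact (h2.hasDerivAt (Icc_mem_nhds ht.1 ht.2)).deriv

theorem isBoundedContinuousOn_of_isCompact {I I' : Set ℝ} {K S : Set (EuclideanSpace ℝ (Fin n))}
    (hI : IsCompact I) (hK : IsCompact K)
    (hz : ContinuousOn (fun q : ℝ × EuclideanSpace ℝ (Fin n) => z q.1 q.2) (I ×ˢ K))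
    (hI' : I' ⊆ I) (hS : S ⊆ K) : IsBoundedContinuousOn I' S z := by
  obtain ⟨C, hC⟩ := (hI.prod hK).exists_bound_of_continuousOn hz
  exact ⟨hz.mono (prod_mono hI' hS), C, fun t ht x hx => hC (t, x) ⟨hI' ht, hS hx⟩⟩

theorem IsBoundedContinuousOn.mono {I I' : Set ℝ} {S : Set (EuclideanSpace ℝ (Fin n))}
    (hz : IsBoundedContinuousOn I S z) (hI : I' ⊆ I) : IsBoundedContinuousOn I' S z :=
  ⟨hz.continuousOn.mono (prod_mono hI le_rfl), hz.bounded.imp fun _ h t ht => h t (hI ht)⟩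

theorem IsBoundedContinuousOn.smul {I : Set ℝ} {S : Set (EuclideanSpace ℝ (Fin n))}
    (hz : IsBoundedContinuousOn I S z) {k : EuclideanSpace ℝ (Fin n) → ℝ} (hk : ContinuousOn k S)
    {C : ℝ} (hC : ∀ x ∈ S, ‖k x‖ ≤ C) : IsBoundedContinuousOn I S fun t x => k x • z t x := by
  obtain ⟨C', hC'⟩ := hz.bounded
  refine ⟨(hk.comp continuousOn_snd fun q hq => hq.2).smul hz.continuousOn, C * C',
    fun t ht x hx => ?_⟩
  rw [norm_smul]
  exact mul_le_mul (hC x hx) (hC' t ht x hx) (norm_nonneg _) ((norm_nonneg _).trans (hC x hx))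

theorem IsBoundedContinuousOn.integrable_mul {I : Set ℝ} {S : Set (EuclideanSpace ℝ (Fin n))}
    {m : Measure (EuclideanSpace ℝ (Fin n))} [IsFiniteMeasure m] (hS : MeasurableSet S)
    (hm : m.restrict S = m) (hz : IsBoundedContinuousOn I S z) (hv : IsBoundedContinuousOn I S v)
    {t τ : ℝ} (ht : t ∈ I) (hτ : τ ∈ I) : Integrable (fun x => z t x * v τ x) m := by
  obtain ⟨C, hC⟩ := hz.bounded
  obtain ⟨C', hC'⟩ := hv.bounded
  have slice : ∀ {w : ℝ → EuclideanSpace ℝ (Fin n) → 𝕜} {s : ℝ}, s ∈ I →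
      IsBoundedContinuousOn I S w → ContinuousOn (w s) S := fun hs hw =>
    hw.continuousOn.comp (f := fun x => (_, x)) (by fun_prop) fun x hx => ⟨hs, hx⟩
  refine Integrable.of_bound (C := C * C') ?_ ?_
  · rw [← hm]
    exact ((slice ht hz).mul (slice hτ hv)).aestronglyMeasurable hS
  · rw [← hm]
    filter_upwards [ae_restrict_mem hS] with x hx
    rw [norm_mul]
    exact mul_le_mul (hC t ht x hx) (hC' τ hτ x hx) (norm_nonneg _)
      ((norm_nonneg _).trans (hC t ht x hx))

theorem surfaceMeasure_restrict_frontier : (surfaceMeasure Ω).restrict (frontier Ω) =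
    surfaceMeasure Ω := by
  rw [surfaceMeasure, Measure.restrict_restrict isClosed_frontier.measurableSet, inter_self]

variable {c : EuclideanSpace ℝ (Fin n) → ℝ}

theorem isBoundedContinuousOn_frontier (hΩ : IsBoundedSmoothDomain Ω) (hαβ : α < β)
    (hz : ContDiffOn ℝ 2 (fun q : ℝ × EuclideanSpace ℝ (Fin n) => z q.1 q.2)
      (Icc α β ×ˢ closure Ω)) :
    IsBoundedContinuousOn (Icc α β) (frontier Ω) (dirichletTrace Ω z) ∧
      IsBoundedContinuousOn (Icc α β) (frontier Ω) (neumannTrace Ω z) := by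
  refine ⟨isBoundedContinuousOn_of_isCompact isCompact_Icc hΩ.isCompact_frontier ?_ le_rfl le_rfl,
    isBoundedContinuousOn_of_isCompact isCompact_Icc hΩ.isCompact_frontier
      (continuousOn_normalDerivative hΩ hαβ hz) le_rfl le_rfl⟩
  refine (hz.continuousOn.mono (prod_mono le_rfl frontier_subset_closure)).congr ?_
  rintro ⟨t, x⟩ ⟨-, hx⟩
  simp [dirichletTrace, indicator_of_mem hx]

/-- Nothing is assumed of `c` on `∂Ω`, so compactness of the closure cannot bound the weight; the
lower bound on `c` does. -/
theorem continuousOn_inv_sq (hc : ContinuousOn c Ω) {c₀ : ℝ} (hc₀ : 0 < c₀)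
    (hcc : ∀ x ∈ Ω, c₀ ≤ c x) : ContinuousOn (fun x => (c x ^ 2)⁻¹) Ω ∧
      ∀ x ∈ Ω, ‖(c x ^ 2)⁻¹‖ ≤ (c₀ ^ 2)⁻¹ := by
  refine ⟨(hc.pow 2).inv₀ fun x hx => (pow_pos (hc₀.trans_le (hcc x hx)) 2).ne', fun x hx => ?_⟩
  rw [Real.norm_of_nonneg (inv_nonneg.2 (sq_nonneg _))]
  have := hcc x hx
  gcongr

/-- The **Blagoveshchenskii identity** on the time interval `[δ, 2T - δ]`. -/
theorem weightedPairing_eq_sub (hΩ : IsBoundedSmoothDomain Ω) (hc : ContinuousOn c Ω)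
    {c₀ : ℝ} (hc₀ : 0 < c₀) (hcc : ∀ x ∈ Ω, c₀ ≤ c x) (hδ : δ < T)
    (hz : ContDiffOn ℝ 2 (fun q : ℝ × EuclideanSpace ℝ (Fin n) => z q.1 q.2)
      (Icc δ (2 * T - δ) ×ˢ closure Ω))
    (hv : ContDiffOn ℝ 2 (fun q : ℝ × EuclideanSpace ℝ (Fin n) => v q.1 q.2)
      (Icc δ (2 * T - δ) ×ˢ closure Ω))
    (hzw : ∀ t ∈ Ioo δ (2 * T - δ), ∀ x ∈ Ω,
      iteratedDeriv 2 (fun s => z s x) t - (c x ^ 2) • (Δ (z t)) x = 0)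
    (hvw : ∀ t ∈ Ioo δ (2 * T - δ), ∀ x ∈ Ω,
      iteratedDeriv 2 (fun s => v s x) t - (c x ^ 2) • (Δ (v t)) x = 0)
    (hz0 : ∀ x ∈ Ω, z δ x = 0)
    (hz1 : ∀ x ∈ Ω, derivWithin (fun s => z s x) (Icc δ (2 * T - δ)) δ = 0) :
    weightedPairing Ω c (z T) (v T) =
      (∫ q, neumannTrace Ω z q.1 q.2 * lowPass T (dirichletTrace Ω v) q.1 q.2
        ∂((volume.restrict (Ioo δ T)).prod (surfaceMeasure Ω))) -
      ∫ q, dirichletTrace Ω z q.1 q.2 * lowPass T (neumannTrace Ω v) q.1 q.2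
        ∂((volume.restrict (Ioo δ T)).prod (surfaceMeasure Ω)) := by
  have hδ' : δ < 2 * T - δ := by linarith
  have hδI : δ ∈ Icc δ (2 * T - δ) := ⟨le_rfl, hδ'.le⟩
  have hK := hΩ.isBounded.isCompact_closure
  have hΩm := hΩ.isOpen.measurableSet
  have : IsFiniteMeasure (volume.restrict Ω) := isFiniteMeasure_restrict.2
    hΩ.isBounded.measure_lt_top.ne
  have := hΩ.isFiniteMeasure_surfaceMeasure
  have hmΩ : (volume.restrict Ω).restrict Ω = volume.restrict Ω := by
    rw [Measure.restrict_restrict hΩm, inter_self]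
  have hm := surfaceMeasure_restrict_frontier (Ω := Ω)
  have hfm : MeasurableSet (frontier Ω) := isClosed_frontier.measurableSet
  have hIoo : Ioo δ (2 * T - δ) ⊆ Icc δ (2 * T - δ) := Ioo_subset_Icc_self
  have hIT : Ioo δ T ⊆ Ioo δ (2 * T - δ) := Ioo_subset_Ioo_right (by linarith)
  obtain ⟨z1, z2, hz1c, hz2c, hdz, hdz1⟩ := exists_time_derivatives hΩ hδ' hz
  obtain ⟨v1, v2, hv1c, hv2c, hdv, hdv1⟩ := exists_time_derivatives hΩ hδ' hv
  set k : EuclideanSpace ℝ (Fin n) → ℝ := fun x => (c x ^ 2)⁻¹ with hk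
  have hcpos : ∀ x ∈ Ω, 0 < c x := fun x hx => hc₀.trans_le (hcc x hx)
  obtain ⟨hkc, hkb⟩ := continuousOn_inv_sq hc hc₀ hcc
  have bc : ∀ {w : ℝ → EuclideanSpace ℝ (Fin n) → 𝕜},
      ContinuousOn (fun q : ℝ × EuclideanSpace ℝ (Fin n) => w q.1 q.2)
        (Icc δ (2 * T - δ) ×ˢ closure Ω) → IsBoundedContinuousOn (Ioo δ (2 * T - δ)) Ω w :=
    fun hw => isBoundedContinuousOn_of_isCompact isCompact_Icc hK hw hIoo subset_closure
  have bw2 := (bc hz2c).smul hkc hkb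
  have bw := (bc hz.continuousOn).smul hkc hkb
  have bv := bc hv.continuousOn
  have bv2 := bc hv2c
  have bzd := (isBoundedContinuousOn_frontier hΩ hδ' hz).1.mono hIoo
  have bzn := (isBoundedContinuousOn_frontier hΩ hδ' hz).2.mono hIoo
  have bvd := (isBoundedContinuousOn_frontier hΩ hδ' hv).1.mono hIoo
  have bvn := (isBoundedContinuousOn_frontier hΩ hδ' hv).2.mono hIoo
  have hz2w : ∀ t ∈ Ioo δ (2 * T - δ), ∀ x ∈ Ω, k x • z2 t x = (Δ (z t)) x := by
    intro t ht x hx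
    rw [← iteratedDeriv_two_eq ht (fun s hs => hdz s hs x (subset_closure hx))
      (hdz1 t (hIoo ht) x (subset_closure hx)), sub_eq_zero.1 (hzw t ht x hx), smul_smul]
    simp only [hk]
    rw [inv_mul_cancel₀ (pow_pos (hcpos x hx) 2).ne', one_smul]
  have hv2w : ∀ t ∈ Ioo δ (2 * T - δ), ∀ x ∈ Ω, k x • v2 t x = (Δ (v t)) x := by
    intro t ht x hx
    rw [← iteratedDeriv_two_eq ht (fun s hs => hdv s hs x (subset_closure hx))
      (hdv1 t (hIoo ht) x (subset_closure hx)), sub_eq_zero.1 (hvw t ht x hx), smul_smul]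
    simp only [hk]
    rw [inv_mul_cancel₀ (pow_pos (hcpos x hx) 2).ne', one_smul]
  have slice : ∀ {w : ℝ → EuclideanSpace ℝ (Fin n) → 𝕜} {x : EuclideanSpace ℝ (Fin n)},
      ContinuousOn (fun q : ℝ × EuclideanSpace ℝ (Fin n) => w q.1 q.2)
        (Icc δ (2 * T - δ) ×ˢ closure Ω) → x ∈ Ω →
      ContinuousOn (fun t => w t x) (Icc δ (2 * T - δ)) := fun hw hx =>
    hw.comp (f := fun t => (t, _)) (by fun_prop) fun t ht => ⟨ht, subset_closure hx⟩
  have hpt : ∀ x ∈ Ω, k x • (z T x * v T x) = ∫ t in Ioo δ T,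
      ((k x • z2 t x) * lowPass T v t x - (k x • z t x) * lowPass T v2 t x) := by
    intro x hx
    have hxK := subset_closure hx
    have hd : ∀ {g g' : ℝ → 𝕜}, (∀ t ∈ Icc δ (2 * T - δ),
        HasDerivWithinAt g (g' t) (Icc δ (2 * T - δ)) t) →
        ∀ t ∈ Ioo δ (2 * T - δ), HasDerivAt g (g' t) t := fun h t ht =>
      (h t (hIoo ht)).hasDerivAt (Icc_mem_nhds ht.1 ht.2)
    have hz10 : z1 δ x = 0 := by
      rw [← (hdz δ hδI x hxK).derivWithin (uniqueDiffOn_Icc hδ' δ hδI), hz1 x hx]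
    have := mul_eq_integral_lowPass hδ (slice hz.continuousOn hx) (slice hz1c hx) (slice hz2c hx)
      (slice hv.continuousOn hx) (slice hv1c hx) (slice hv2c hx)
      (hd fun t ht => hdz t ht x hxK) (hd fun t ht => hdz1 t ht x hxK)
      (hd fun t ht => hdv t ht x hxK) (hd fun t ht => hdv1 t ht x hxK) (hz0 x hx) hz10
    rw [this, intervalIntegral.integral_of_le hδ.le, integral_Ioc_eq_integral_Ioo, ← integral_smul]
    refine integral_congr_ae (ae_of_all _ fun t => ?_)
    simp only [lowPass, smul_sub, smul_mul_assoc]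
  have i1 := integrable_mul_lowPass hΩm hmΩ (bw2.mono hIT) bv
  have i2 := integrable_mul_lowPass hΩm hmΩ (bw.mono hIT) bv2
  have t1 := (integrable_timeTriangle_prod hΩm hmΩ (bw2.mono hIT) bv).integral_prod_left
  have t2 := (integrable_timeTriangle_prod hΩm hmΩ (bw.mono hIT) bv2).integral_prod_left
  have t3 := (integrable_timeTriangle_prod hfm hm (bzn.mono hIT) bvd).integral_prod_left
  have t4 := (integrable_timeTriangle_prod hfm hm (bzd.mono hIT) bvn).integral_prod_left
  have e1 : weightedPairing Ω c (z T) (v T) =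
      ∫ q, (k q.2 • z2 q.1 q.2) * lowPass T v q.1 q.2 - (k q.2 • z q.1 q.2) *
        lowPass T v2 q.1 q.2 ∂((volume.restrict (Ioo δ T)).prod (volume.restrict Ω)) := by
    exact (setIntegral_congr_fun hΩm hpt).trans (integral_prod_symm _ (i1.sub i2)).symm
  rw [e1, integral_sub i1 i2, integral_mul_lowPass hΩm hmΩ (bw2.mono hIT) bv,
    integral_mul_lowPass hΩm hmΩ (bw.mono hIT) bv2,
    integral_mul_lowPass hfm hm (bzn.mono hIT) bvd,
    integral_mul_lowPass hfm hm (bzd.mono hIT) bvn, ← smul_sub, ← smul_sub,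
    ← integral_sub t1 t2, ← integral_sub t3 t4]
  congr 1
  -- Both sides are now integrals over the same triangle. It remains to compare the integrands,
  -- which is Green's identity between `z` at time `t` and `v` at another time `τ`.
  refine setIntegral_congr_fun (isOpen_timeTriangle δ T).measurableSet fun q hq => ?_
  obtain ⟨ht, hτ⟩ := timeTriangle_subset δ T hq
  change (∫ x in Ω, (k x • z2 q.1 x) * v q.2 x) - (∫ x in Ω, (k x • z q.1 x) * v2 q.2 x) =
    (∫ x, neumannTrace Ω z q.1 x * dirichletTrace Ω v q.2 x ∂(surfaceMeasure Ω)) -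
    ∫ x, dirichletTrace Ω z q.1 x * neumannTrace Ω v q.2 x ∂(surfaceMeasure Ω)
  rw [← integral_sub (bw2.integrable_mul hΩm hmΩ bv ht hτ) (bw.integrable_mul hΩm hmΩ bv2 ht hτ),
    ← integral_sub (bzn.integrable_mul hfm hm bvd ht hτ) (bzd.integrable_mul hfm hm bvn ht hτ)]
  calc _ = ∫ x in Ω, ((Δ (z q.1)) x * v q.2 x - z q.1 x * (Δ (v q.2)) x) := by
        refine setIntegral_congr_fun hΩm fun x hx => ?_
        rw [hz2w _ ht x hx, ← hv2w _ hτ x hx, smul_mul_assoc, mul_smul_comm]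
    _ = _ := by
        rw [hΩ.integral_laplacian_mul_sub (contDiffOn_slice hz (hIoo ht))
          (contDiffOn_slice hv (hIoo hτ))]
        refine setIntegral_congr_fun hfm fun x hx => ?_
        simp only [neumannTrace, dirichletTrace, indicator_of_mem hx]

end Core

/-! ### Uniqueness for the Neumann problem. -/

section Uniqueness

variable {𝕜 : Type*} [RCLike 𝕜] {n : ℕ} {Ω : Set (EuclideanSpace ℝ (Fin n))}
  {c : EuclideanSpace ℝ (Fin n) → ℝ} {S T : ℝ} {f u w : ℝ → EuclideanSpace ℝ (Fin n) → 𝕜}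

theorem contDiffOn_time_slice {k : WithTop ℕ∞} {I : Set ℝ} {K : Set (EuclideanSpace ℝ (Fin n))}
    (hw : ContDiffOn ℝ k (fun q : ℝ × EuclideanSpace ℝ (Fin n) => w q.1 q.2) (I ×ˢ K))
    {x : EuclideanSpace ℝ (Fin n)} (hx : x ∈ K) : ContDiffOn ℝ k (fun t => w t x) I :=
  hw.comp (f := fun t : ℝ => (t, x)) (contDiff_id.prodMk contDiff_const).contDiffOn
    fun _ ht => ⟨ht, hx⟩

theorem IsNeumannSolution.mono (hu : IsNeumannSolution Ω c S f u) {S' : ℝ} (h : S' ≤ S) :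
    IsNeumannSolution Ω c S' f u where
  contDiffOn := hu.contDiffOn.mono (prod_mono (Ico_subset_Ico_right h) le_rfl)
  wave t ht := hu.wave t ⟨ht.1, ht.2.trans_le h⟩
  neumann t ht := hu.neumann t ⟨ht.1, ht.2.trans_le h⟩
  initial := hu.initial
  initial_deriv := hu.initial_deriv

theorem IsNeumannSolution.sub (hΩ : IsBoundedSmoothDomain Ω) (hS : 0 < S)
    (hu : IsNeumannSolution Ω c S f u) (hw : IsNeumannSolution Ω c S f w) :
    IsNeumannSolution Ω c S 0 (fun t x => u t x - w t x) where
  contDiffOn := hu.contDiffOn.sub hw.contDiffOn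
  wave t ht x hx := by
    have hxK := subset_closure hx
    have hI : Ico 0 S ∈ nhds t := Ico_mem_nhds ht.1 ht.2
    have hn : closure Ω ∈ nhds x := Filter.mem_of_superset (hΩ.isOpen.mem_nhds hx) subset_closure
    have htI : t ∈ Ico 0 S := Ioo_subset_Ico_self ht
    have h1 : iteratedDeriv 2 (fun s => u s x - w s x) t = _ :=
      iteratedDeriv_fun_sub (n := 2) ((contDiffOn_time_slice hu.contDiffOn hxK).contDiffAt hI)
        ((contDiffOn_time_slice hw.contDiffOn hxK).contDiffAt hI)
    have h2 : (Δ (fun x => u t x - w t x)) x = _ :=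
      ((contDiffOn_slice hu.contDiffOn htI).contDiffAt hn).laplacian_sub
        ((contDiffOn_slice hw.contDiffOn htI).contDiffAt hn)
    rw [h1, h2, sub_eq_zero.1 (hu.wave t ht x hx), sub_eq_zero.1 (hw.wave t ht x hx), smul_sub,
      sub_self]
  neumann t ht x hx := by
    have hxK := frontier_subset_closure hx
    have htI : t ∈ Ico 0 S := Ioo_subset_Ico_self ht
    have h1 := hu.neumann t ht x hx
    have h2 := hw.neumann t ht x hx
    simp only [neumannTrace, indicator_of_mem hx] at h1 h2 ⊢
    rw [fderivWithin_fun_sub (hΩ.uniqueDiffOn_closure x hxK)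
      ((contDiffOn_slice hu.contDiffOn htI).differentiableOn (by simp) x hxK)
      ((contDiffOn_slice hw.contDiffOn htI).differentiableOn (by simp) x hxK), sub_apply, h1, h2]
    simp
  initial x hx := by rw [hu.initial x hx, hw.initial x hx, sub_zero]
  initial_deriv x hx := by
    -- The initial velocity is a derivative within `[0, ∞)`, the regularity is known on `[0, S)`;
    -- the two sets agree near `0`.
    have hset : Ico 0 S =ᶠ[nhds 0] Ici 0 := by
      filter_upwards [Iio_mem_nhds hS] with s hs
      exact propext ⟨fun h => h.1, fun h => ⟨h, hs⟩⟩
    have hd : ∀ {w : ℝ → EuclideanSpace ℝ (Fin n) → 𝕜},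
        ContDiffOn ℝ 2 (fun q : ℝ × EuclideanSpace ℝ (Fin n) => w q.1 q.2)
          (Ico 0 S ×ˢ closure Ω) → DifferentiableWithinAt ℝ (fun s => w s x) (Ici 0) 0 :=
      fun hw => (differentiableWithinAt_congr_set hset).1
        ((contDiffOn_time_slice hw (subset_closure hx)).differentiableOn (by simp) 0 ⟨le_rfl, hS⟩)
    rw [derivWithin_fun_sub (hd hu.contDiffOn) (hd hw.contDiffOn), hu.initial_deriv x hx,
      hw.initial_deriv x hx, sub_zero]

/-- A solution with vanishing Neumann data on `(0, S)` vanishes on `(0, S / 2)`. -/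
theorem IsNeumannSolution.eq_zero (hΩ : IsBoundedSmoothDomain Ω) (hc : ContinuousOn c Ω)
    {c₀ : ℝ} (hc₀ : 0 < c₀) (hcc : ∀ x ∈ Ω, c₀ ≤ c x) (hw : IsNeumannSolution Ω c S f w)
    (hf : ∀ t ∈ Ioo 0 S, ∀ x ∈ frontier Ω, f t x = 0) (hT : 0 < T) (hTS : 2 * T < S) :
    ∀ x ∈ closure Ω, w T x = 0 := by
  have hΩm := hΩ.isOpen.measurableSet
  have hfm : MeasurableSet (frontier Ω) := isClosed_frontier.measurableSet
  have hfin : IsFiniteMeasure (volume.restrict Ω) := isFiniteMeasure_restrict.2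
    hΩ.isBounded.measure_lt_top.ne
  have := hΩ.isFiniteMeasure_surfaceMeasure
  -- The identity is used with `δ = 0`, as `w` is `C²` down to the initial time. It needs the closed
  -- interval `[0, 2T]` inside `[0, S)`, hence `2T < S`.
  have hIcc : Icc 0 (2 * T - 0) ⊆ Ico 0 S := fun t ht => ⟨ht.1, by linarith [ht.2]⟩
  have hIoo : Ioo 0 (2 * T - 0) ⊆ Ioo 0 S := fun t ht => ⟨ht.1, by linarith [ht.2]⟩
  have hTI : T ∈ Icc 0 (2 * T - 0) := ⟨hT.le, by linarith⟩
  have hz := hw.contDiffOn.mono (prod_mono hIcc (le_refl (closure Ω)))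
  -- The pairings are bilinear, so the conjugate is needed to produce `|w|²`. It solves the same
  -- equation because `c` is real, and its Neumann data vanish too.
  set v : ℝ → EuclideanSpace ℝ (Fin n) → 𝕜 := fun t x => star (w t x) with hv
  have hvc : ContDiffOn ℝ 2 (fun q : ℝ × EuclideanSpace ℝ (Fin n) => v q.1 q.2)
      (Icc 0 (2 * T - 0) ×ˢ closure Ω) := (RCLike.conjCLE (K := 𝕜)).contDiff.comp_contDiffOn hz
  have hvw : ∀ t ∈ Ioo 0 (2 * T - 0), ∀ x ∈ Ω,
      iteratedDeriv 2 (fun s => v s x) t - (c x ^ 2) • (Δ (v t)) x = 0 := by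
    intro t ht x hx
    have h1 : iteratedDeriv 2 (fun s => v s x) t = star (iteratedDeriv 2 (fun s => w s x) t) := by
      have : deriv (fun s => v s x) = fun s => star (deriv (fun s => w s x) s) :=
        funext fun s => deriv.star
      rw [iteratedDeriv_succ, iteratedDeriv_one, this, deriv.star, iteratedDeriv_succ,
        iteratedDeriv_one]
    have h2 : (Δ (v t)) x = star ((Δ (w t)) x) :=
      congrFun (InnerProductSpace.laplacian_CLE_comp_left (f := w t) (l := RCLike.conjCLE (K := 𝕜))) x
    rw [h1, h2, sub_eq_zero.1 (hw.wave t (hIoo ht) x hx), star_smul, star_trivial, sub_self]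
  have hwN : ∀ t ∈ Ioo 0 S, ∀ x, neumannTrace Ω w t x = 0 := by
    intro t ht x
    by_cases hx : x ∈ frontier Ω
    · rw [hw.neumann t ht x hx, hf t ht x hx]
    · simp [neumannTrace, hx]
  have hvN : ∀ t ∈ Ioo 0 S, ∀ x, neumannTrace Ω v t x = 0 := by
    intro t ht x
    by_cases hx : x ∈ frontier Ω
    · have h1 := hwN t ht x
      simp only [neumannTrace, indicator_of_mem hx] at h1 ⊢
      have h2 : fderivWithin ℝ (v t) (closure Ω) x = _ :=
        (RCLike.conjCLE (K := 𝕜)).comp_fderivWithin (f := w t)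
          (hΩ.uniqueDiffOn_closure x (frontier_subset_closure hx))
      rw [h2, ContinuousLinearMap.comp_apply, h1, map_zero]
    · simp [neumannTrace, hx]
  have hcore := weightedPairing_eq_sub hΩ hc hc₀ hcc hT hz hvc
    (fun t ht => hw.wave t (hIoo ht)) hvw hw.initial (fun x hx => by
      rw [← hw.initial_deriv x hx]
      refine derivWithin_congr_set ?_
      filter_upwards [Iio_mem_nhds (show (0 : ℝ) < 2 * T - 0 by linarith)] with s hs
      exact propext ⟨fun h => h.1, fun h => ⟨h, le_of_lt hs⟩⟩)
  have hae := ae_prod_mem (m := surfaceMeasure Ω) hfm surfaceMeasure_restrict_frontier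
    (measurableSet_Ioo (a := (0 : ℝ)) (b := T))
  have hr1 : ∫ q, neumannTrace Ω w q.1 q.2 * lowPass T (dirichletTrace Ω v) q.1 q.2
      ∂((volume.restrict (Ioo 0 T)).prod (surfaceMeasure Ω)) = 0 := by
    refine integral_eq_zero_of_ae ?_
    filter_upwards [hae] with q hq
    rw [hwN q.1 ⟨hq.1.1, by linarith [hq.1.2]⟩, zero_mul, Pi.zero_apply]
  have hr2 : ∫ q, dirichletTrace Ω w q.1 q.2 * lowPass T (neumannTrace Ω v) q.1 q.2
      ∂((volume.restrict (Ioo 0 T)).prod (surfaceMeasure Ω)) = 0 := by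
    refine integral_eq_zero_of_ae ?_
    filter_upwards [hae] with q hq
    rw [lowPass_eq_setIntegral _ hq.1.2.le, setIntegral_congr_fun (g := fun _ => 0)
      measurableSet_Ioo fun τ hτ => hvN τ ⟨hq.1.1.trans hτ.1, by linarith [hτ.2, hq.1.1]⟩ q.2]
    simp
  rw [hr1, hr2, sub_zero] at hcore
  obtain ⟨hkc, hkb⟩ := continuousOn_inv_sq hc hc₀ hcc
  have hwc : ContinuousOn (w T) (closure Ω) := (contDiffOn_slice hz hTI).continuousOn
  obtain ⟨C, hC⟩ := hΩ.isBounded.isCompact_closure.exists_bound_of_continuousOn hwc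
  have hgc : ContinuousOn (fun x => (c x ^ 2)⁻¹ * ‖w T x‖ ^ 2) Ω :=
    hkc.mul ((hwc.mono subset_closure).norm.pow 2)
  have hgint : IntegrableOn (fun x => (c x ^ 2)⁻¹ * ‖w T x‖ ^ 2) Ω := by
    refine Integrable.of_bound (C := (c₀ ^ 2)⁻¹ * C ^ 2) (hgc.aestronglyMeasurable hΩm) ?_
    filter_upwards [ae_restrict_mem hΩm] with x hx
    rw [norm_mul, norm_pow, norm_norm]
    have := hkb x hx
    have := hC x (subset_closure hx)
    gcongr
  have hint0 : ∫ x in Ω, (c x ^ 2)⁻¹ * ‖w T x‖ ^ 2 = 0 := by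
    rw [← RCLike.ofReal_eq_zero (K := 𝕜), ← integral_ofReal, ← hcore]
    refine integral_congr_ae (ae_of_all _ fun x => ?_)
    change _ = ((c x ^ 2)⁻¹ : ℝ) • (w T x * (starRingEnd 𝕜) (w T x))
    rw [RCLike.mul_conj, RCLike.real_smul_eq_coe_mul]
    push_cast
    rfl
  rw [setIntegral_eq_zero_iff_of_nonneg_ae (ae_of_all _ fun x => by positivity) hgint] at hint0
  -- A continuous function that vanishes almost everywhere on an open set vanishes there; continuity
  -- of `w(T)` then carries this to the closure.
  have hEq := Measure.eqOn_open_of_ae_eq hint0 hΩ.isOpen hgc continuousOn_const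
  have hzero : EqOn (w T) (fun _ => 0) Ω := fun x hx => by
    have h1 : (c x ^ 2)⁻¹ * ‖w T x‖ ^ 2 = 0 := hEq hx
    have h2 : 0 < (c x ^ 2)⁻¹ := inv_pos.2 (pow_pos (hc₀.trans_le (hcc x hx)) 2)
    simpa [h2.ne', inv_eq_zero] using (mul_eq_zero.1 h1).resolve_left h2.ne'
  exact hzero.of_subset_closure hwc continuousOn_const subset_closure le_rfl

end Uniqueness

/-! ### Small times, the Neumann-to-Dirichlet map, and the theorem. -/

section Main

variable {𝕜 : Type*} [RCLike 𝕜] {n : ℕ} {Ω : Set (EuclideanSpace ℝ (Fin n))}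
  {c : EuclideanSpace ℝ (Fin n) → ℝ} {S T : ℝ} {f u : ℝ → EuclideanSpace ℝ (Fin n) → 𝕜}

/-- The solution chosen in the definition need not be `u` itself, but by uniqueness the two agree on
the first half of `(0, 2T)`. -/
theorem neumannToDirichlet_eq (hΩ : IsBoundedSmoothDomain Ω) (hc : ContinuousOn c Ω)
    {c₀ : ℝ} (hc₀ : 0 < c₀) (hcc : ∀ x ∈ Ω, c₀ ≤ c x) (hu : IsNeumannSolution Ω c (2 * T) f u)
    {t : ℝ} (ht : t ∈ Ioo 0 T) (x : EuclideanSpace ℝ (Fin n)) :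
    neumannToDirichlet Ω c (2 * T) f t x = dirichletTrace Ω u t x := by
  have h : ∃ u, IsNeumannSolution Ω c (2 * T) f u := ⟨u, hu⟩
  rw [neumannToDirichlet, dif_pos h]
  by_cases hx : x ∈ frontier Ω
  · have hsub := h.choose_spec.sub hΩ (by linarith [ht.1, ht.2]) hu
    have := hsub.eq_zero hΩ hc hc₀ hcc (fun _ _ _ _ => rfl) ht.1 (by linarith [ht.2]) x
      (frontier_subset_closure hx)
    simp only [dirichletTrace, indicator_of_mem hx]
    exact sub_eq_zero.1 this
  · simp [dirichletTrace, hx]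

/-- The projection of the compact support to the time axis is closed and does not contain `0`. -/
theorem IsSmoothCompactBoundaryData.exists_eq_zero (hf : IsSmoothCompactBoundaryData Ω S f)
    (hS : 0 < S) :
    ∃ ε ∈ Ioc 0 S, ∀ t ∈ Ioo 0 ε, ∀ x ∈ frontier Ω, f t x = 0 := by
  obtain ⟨-, K, hK, hKs, hfK⟩ := hf
  have hcl : IsClosed (Prod.fst '' K) := (hK.image continuous_fst).isClosed
  have h0 : (0 : ℝ) ∈ (Prod.fst '' K)ᶜ := by
    rintro ⟨q, hq, hq0⟩
    have := (hKs hq).1.1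
    rw [hq0] at this
    exact lt_irrefl _ this
  obtain ⟨r, hr, hball⟩ := Metric.isOpen_iff.1 hcl.isOpen_compl 0 h0
  refine ⟨min r S, ⟨lt_min hr hS, min_le_right _ _⟩, fun t ht x hx => ?_⟩
  refine hfK (t, x) ⟨⟨⟨ht.1, ht.2.trans_le (min_le_right _ _)⟩, hx⟩, fun hq => ?_⟩
  refine hball (a := t) ?_ ⟨_, hq, rfl⟩
  rw [Metric.mem_ball, Real.dist_0_eq_abs, abs_of_pos ht.1]
  exact ht.2.trans_le (min_le_left _ _)

/-- A pairing on `(0, T) × ∂Ω` with a function that vanishes up to the time `δ`. -/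
theorem lateralPairing_eq_of_eq_zero {δ : ℝ} (hδ : 0 ≤ δ) (hΩ : IsBoundedSmoothDomain Ω)
    {g a h : ℝ → EuclideanSpace ℝ (Fin n) → 𝕜}
    (hg : ∀ t ∈ Ioo δ T, ∀ x ∈ frontier Ω, g t x = a t x)
    (hg0 : ∀ t ∈ Ioc 0 δ, ∀ x ∈ frontier Ω, g t x = 0)
    (hint : Integrable (fun q : ℝ × EuclideanSpace ℝ (Fin n) => a q.1 q.2 * h q.1 q.2)
      ((volume.restrict (Ioo δ T)).prod (surfaceMeasure Ω))) :
    LateralPairable Ω T (timeRestrict T g) h ∧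
      lateralPairing Ω T (timeRestrict T g) h =
        ∫ q, a q.1 q.2 * h q.1 q.2 ∂((volume.restrict (Ioo δ T)).prod (surfaceMeasure Ω)) := by
  have := hΩ.isFiniteMeasure_surfaceMeasure
  have hA : MeasurableSet (Ioo δ T ×ˢ (univ : Set (EuclideanSpace ℝ (Fin n)))) :=
    measurableSet_Ioo.prod MeasurableSet.univ
  have hres : (lateralMeasure Ω T).restrict (Ioo δ T ×ˢ univ) =
      (volume.restrict (Ioo δ T)).prod (surfaceMeasure Ω) := by
    rw [lateralMeasure, ← Measure.prod_restrict, Measure.restrict_restrict measurableSet_Ioo,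
      Measure.restrict_univ, inter_eq_self_of_subset_left (Ioo_subset_Ioo_left hδ)]
  -- Up to time `δ` the factor `g` vanishes, so the values of `h` there do not matter. In the
  -- application `h` involves `v` near `0` and `2T`, where it may be unbounded.
  have hae : (fun q : ℝ × EuclideanSpace ℝ (Fin n) => timeRestrict T g q.1 q.2 * h q.1 q.2)
      =ᵐ[lateralMeasure Ω T] (Ioo δ T ×ˢ univ).indicator fun q => a q.1 q.2 * h q.1 q.2 := by
    filter_upwards [ae_prod_mem (m := surfaceMeasure Ω) isClosed_frontier.measurableSet
      surfaceMeasure_restrict_frontier (measurableSet_Ioo (a := (0 : ℝ)) (b := T))] with q hq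
    rw [timeRestrict, indicator_of_mem hq.1]
    by_cases hqδ : δ < q.1
    · rw [indicator_of_mem (show q ∈ Ioo δ T ×ˢ univ from ⟨⟨hqδ, hq.1.2⟩, mem_univ _⟩),
        hg q.1 ⟨hqδ, hq.1.2⟩ q.2 hq.2]
    · rw [indicator_of_notMem (fun h : q ∈ Ioo δ T ×ˢ univ => hqδ h.1.1),
        hg0 q.1 ⟨hq.1.1, not_lt.1 hqδ⟩ q.2 hq.2, zero_mul]
  constructor
  · rw [LateralPairable, integrable_congr hae, integrable_indicator_iff hA, IntegrableOn, hres]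
    exact hint
  · rw [lateralPairing, integral_congr_ae hae, integral_indicator hA, hres]

end Main
end

theorem mainTheorem4 {𝕜 : Type*} [RCLike 𝕜] {n : ℕ} (hn : 1 ≤ n)
    (Ω : Set (EuclideanSpace ℝ (Fin n))) (hΩ : IsBoundedSmoothDomain Ω)
    (T : ℝ) (hT : 0 < T)
    (c : EuclideanSpace ℝ (Fin n) → ℝ) (hc : ContDiffOn ℝ ∞ c Ω)
    (hc_bdd : ∃ c₀ c₁ : ℝ, 0 < c₀ ∧ ∀ x ∈ Ω, c₀ ≤ c x ∧ c x ≤ c₁)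
    (f : ℝ → EuclideanSpace ℝ (Fin n) → 𝕜) (hf : IsSmoothCompactBoundaryData Ω (2 * T) f)
    (u : ℝ → EuclideanSpace ℝ (Fin n) → 𝕜) (hu : IsNeumannSolution Ω c (2 * T) f u)
    (v : ℝ → EuclideanSpace ℝ (Fin n) → 𝕜)
    (hv : ContDiffOn ℝ ∞ (fun p : ℝ × EuclideanSpace ℝ (Fin n) => v p.1 p.2)
      (Ioo 0 (2 * T) ×ˢ closure Ω))
    (hv_wave : SatisfiesWaveEquation Ω c (2 * T) v) :
    (WeightedPairable Ω c (u T) (v T) ∧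
      LateralPairable Ω T (timeRestrict T f) (lowPass T (dirichletTrace Ω v)) ∧
      LateralPairable Ω T (timeRestrict T (neumannToDirichlet Ω c (2 * T) f))
        (lowPass T (neumannTrace Ω v))) ∧
    weightedPairing Ω c (u T) (v T) =
      lateralPairing Ω T (timeRestrict T f) (lowPass T (dirichletTrace Ω v)) -
        lateralPairing Ω T (timeRestrict T (neumannToDirichlet Ω c (2 * T) f))
          (lowPass T (neumannTrace Ω v)) := by
  obtain ⟨c₀, c₁, hc₀, hcc₁⟩ := hc_bdd
  have hcc : ∀ x ∈ Ω, c₀ ≤ c x := fun x hx => (hcc₁ x hx).1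
  have hcont := hc.continuousOn
  obtain ⟨ε, ⟨hε0, hεT⟩, hfε⟩ := hf.exists_eq_zero (by linarith)
  have hu0 : ∀ t ∈ Ioo 0 (ε / 2), ∀ x ∈ closure Ω, u t x = 0 := fun t ht =>
    (hu.mono hεT).eq_zero hΩ hcont hc₀ hcc hfε ht.1 (by linarith [ht.2])
  -- Since `u` vanishes on all of `(0, ε/2)`, it vanishes in a neighbourhood of `δ`, so both its
  -- value and its velocity are zero at `δ`. Moreover `ε ≤ 2T` gives `δ < T`.
  set δ := ε / 4 with hδ
  have hδ0 : 0 < δ := by positivity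
  have hδT : δ < T := by linarith
  have hδε : δ < ε / 2 := by linarith
  have hIcc : Icc δ (2 * T - δ) ⊆ Ioo 0 (2 * T) := fun t ht =>
    ⟨hδ0.trans_le ht.1, by linarith [ht.2]⟩
  have hIoo : Ioo δ (2 * T - δ) ⊆ Icc δ (2 * T - δ) := Ioo_subset_Icc_self
  have hIT : Ioo δ T ⊆ Ioo δ (2 * T - δ) := Ioo_subset_Ioo_right (by linarith)
  have hTI : T ∈ Icc δ (2 * T - δ) := ⟨hδT.le, by linarith⟩
  have huc := hu.contDiffOn.mono
    (prod_mono (hIcc.trans Ioo_subset_Ico_self) (le_refl (closure Ω)))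
  have hvc : ContDiffOn ℝ 2 (fun p : ℝ × EuclideanSpace ℝ (Fin n) => v p.1 p.2)
      (Icc δ (2 * T - δ) ×ˢ closure Ω) :=
    (hv.mono (prod_mono hIcc (le_refl (closure Ω)))).of_le (WithTop.coe_le_coe.2 le_top)
  have hcore := weightedPairing_eq_sub hΩ hcont hc₀ hcc hδT huc hvc
    (fun t ht => hu.wave t (hIcc (hIoo ht))) (fun t ht => hv_wave t (hIcc (hIoo ht)))
    (fun x hx => hu0 δ ⟨hδ0, hδε⟩ x (subset_closure hx)) (fun x hx => by
      have h1 : (fun s => u s x) =ᶠ[nhds δ] fun _ => 0 := by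
        filter_upwards [Ioo_mem_nhds hδ0 hδε] with s hs using hu0 s hs x (subset_closure hx)
      rw [(h1.filter_mono nhdsWithin_le_nhds).derivWithin_eq h1.eq_of_nhds]
      simp)
  have := hΩ.isFiniteMeasure_surfaceMeasure
  have hfm : MeasurableSet (frontier Ω) := isClosed_frontier.measurableSet
  have hm := surfaceMeasure_restrict_frontier (Ω := Ω)
  have hδ' : δ < 2 * T - δ := by linarith
  obtain ⟨bud, bun⟩ := isBoundedContinuousOn_frontier hΩ hδ' huc
  obtain ⟨bvd, bvn⟩ := isBoundedContinuousOn_frontier hΩ hδ' hvc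
  obtain ⟨p1, q1⟩ := lateralPairing_eq_of_eq_zero hδ0.le hΩ (g := f)
    (fun t ht x hx => (hu.neumann t (hIcc (hIoo (hIT ht))) x hx).symm)
    (fun t ht x hx => hfε t ⟨ht.1, by linarith [ht.2]⟩ x hx)
    (integrable_mul_lowPass hfm hm (bun.mono (hIT.trans hIoo)) (bvd.mono hIoo))
  obtain ⟨p2, q2⟩ := lateralPairing_eq_of_eq_zero hδ0.le hΩ
    (g := neumannToDirichlet Ω c (2 * T) f)
    (fun t ht x _ => neumannToDirichlet_eq hΩ hcont hc₀ hcc hu ⟨hδ0.trans ht.1, ht.2⟩ x)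
    (fun t ht x hx => by
      rw [neumannToDirichlet_eq hΩ hcont hc₀ hcc hu ⟨ht.1, ht.2.trans_lt hδT⟩ x, dirichletTrace,
        indicator_of_mem hx, hu0 t ⟨ht.1, ht.2.trans_lt hδε⟩ x (frontier_subset_closure hx)])
    (integrable_mul_lowPass hfm hm (bud.mono (hIT.trans hIoo)) (bvn.mono hIoo))
  refine ⟨⟨?_, p1, p2⟩, by rw [hcore, q1, q2]⟩
  have hfin : IsFiniteMeasure (volume.restrict Ω) := isFiniteMeasure_restrict.2
    hΩ.isBounded.measure_lt_top.ne
  have hΩm := hΩ.isOpen.measurableSet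
  obtain ⟨hkc, hkb⟩ := continuousOn_inv_sq hcont hc₀ hcc
  have hK := hΩ.isBounded.isCompact_closure
  have bu := isBoundedContinuousOn_of_isCompact isCompact_Icc hK huc.continuousOn le_rfl
    subset_closure
  have bv := isBoundedContinuousOn_of_isCompact isCompact_Icc hK hvc.continuousOn le_rfl
    subset_closure
  have hint := (bu.smul hkc hkb).integrable_mul (m := volume.restrict Ω) hΩm
    (by rw [Measure.restrict_restrict hΩm, inter_self]) bv hTI hTI
  simpa only [WeightedPairable, IntegrableOn, smul_mul_assoc] using hint
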